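/- **Setting.** An urn contains white and black balls. Fix a sample size $m\ge 1$, a balance $\sigma\ge 1$, integers $a_k,b_k$ $(0\le k\le m)$ with $a_k+b_k=\sigma$, and initial numbers $W_0,B_0\ge 0$ of white and black balls with $T_0=W_0+B_0\ge m$. At each step $m$ balls are drawn, either without replacement (model $\mathcal M$) or with replacement (model $\mathcal R$), and put back; if $k$ of them are white, $a_{m-k}$ white and $b_{m-k}$ black balls are added. Let $W_n$ be the number of white balls after $n$ draws and $T_n=T_0+\sigma n$ the total number of balls. So, given the first $n$ draws, with $w$ white and $b$ black balls in the urn, the next sample contains exactly $k$ white balls with probability $\binom wk\binom b{m-k}/\binom{w+b}m$ in model $\mathcal M$ and $\binom mk w^kb^{m-k}/(w+b)^m$ in model $\mathcal R$. Assume that the urn is tenable (no configuration that is reached with positive probability has a negative number of balls of some color) and affine (there are deterministic $\alpha_n,\beta_n$ such that, for each $n$ and each configuration with $w$ white balls among $T_n$ balls, the expected number of white balls after the next draw is $\alpha_n w+\beta_n$). Put $$\Lambda=\frac m\sigma(a_{m-1}-a_m),\qquad C=\frac{\Lambda\sigma}{m},\qquad \tilde W_n=W_n-\frac{a_m}{1-\Lambda}\,n,$$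 where $\frac{a_m}{1-\Lambda}$ (and any term containing it) is read as $0$ if $a_m=0$, also when $\Lambda=1$. With $\left[{h\atop \ell}\right]$ and $\left\{{i\atop h}\right\}$ the (unsigned) Stirling numbers of the first and second kind and $x^{\underline\ell}=x(x-1)\cdots(x-\ell+1)$, let for $n\ge1$ $$p_{n;(i,\ell)}=\begin{cases}\displaystyle\sum_{h=\ell}^{\min\{i,m\}}(-1)^{h-\ell}\,\frac{\left[{h\atop \ell}\right]\left\{{i\atop h}\right\}\binom mh}{\binom{T_{n-1}}h}&\text{in model }\mathcal M,\\[2ex] \displaystyle\left\{{i\atop \ell}\right\}\frac{m^{\underline \ell}}{T_{n-1}^{\ell}}&\text{in model }\mathcal R,\end{cases}$$ and, for $0\le r\le s$, $$f_{n,s,r}=\sum_{j=s-r}^{s}\binom sj\Lambda^j\sum_{\ell=j-(s-r)}^{j}\binom{\ell}{j-(s-r)}\Big(\frac{a_m(n-1)}{1-\Lambda}\Big)^{\ell-j+s-r}\sum_{i=\ell}^{j}\binom ji\frac{\sigma^i a_m^{j-i}}{m^i(\Lambda-1)^{j-i}}\,p_{n;(i,\ell)}$$ (with $0^0=1$). **Theorem.**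 Suppose that the urn has large index, $\Lambda>\frac12$, or is triangular, $a_m=0$ and $a_{m-1}>0$. Then for every integer $s\ge1$ the limit $$E_s=\lim_{n\to\infty}\mathbb E\Big[\frac{\tilde W_n^s}{n^{s\Lambda}}\Big]$$ exists (and is finite), and $$E_1=\Big(W_0-\frac{a_mT_0/\sigma}{1-\Lambda}\Big)\frac{\Gamma(\frac{T_0}\sigma)}{\Gamma(\frac{T_0}\sigma+\Lambda)}.$$ For every $s\ge1$ we have $f_{j,s,s}>0$ for all $j\ge1$, and the series $$\Sigma_s=\sum_{\ell=1}^\infty\frac{\sum_{i=0}^{s-1}f_{\ell,s,i}\,\mathbb E[\tilde W_{\ell-1}^i]}{\prod_{j=1}^{\ell}f_{j,s,s}}$$ converges absolutely. Moreover, for every $s\ge 1$: * In model $\mathcal M$, with $s^*=\min\{s,m\}$, the polynomial $$P_s(x)=\frac{s^*!}{\sigma^{s^*}}\sum_{\ell=0}^{s^*}\frac{\binom s\ell}{\binom{s^*}\ell}C^\ell\binom m\ell\binom{x\sigma+T_0-\ell}{s^*-\ell}$$ is monic of degree $s^*$; if $\lambda_{1,s},\dots,\lambda_{s^*,s}$ denote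 its negated complex roots (with multiplicity), none of them is in $\{0,-1,-2,\dots\}$, and $$E_s=\bigg(\prod_{\ell=1}^{s^*}\frac{\Gamma(\frac{T_0+1-\ell}\sigma)}{\Gamma(\lambda_{\ell,s})}\bigg)\big(W_0^s+\Sigma_s\big).$$ * In model $\mathcal R$, the polynomial $$Q_s(x)=\frac1{\sigma^s}\sum_{\ell=0}^{s}\binom s\ell C^\ell\binom m\ell\,\ell!\,(x\sigma+T_0)^{s-\ell}$$ is monic of degree $s$; if $\mu_{1,s},\dots,\mu_{s,s}$ denote its negated complex roots (with multiplicity), none of them is in $\{0,-1,-2,\dots\}$, and $$E_s=\frac{\Gamma(\frac{T_0}\sigma)^s}{\prod_{\ell=1}^{s}\Gamma(\mu_{\ell,s})}\big(W_0^s+\Sigma_s\big).$$ -/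

import Mathlib

open MeasureTheory ProbabilityTheory Filter Topology
open scoped Polynomial

noncomputable section

/-- The two ways of drawing a sample of `m` balls: without replacement (model `M`) and
with replacement (model `R`). -/
inductive SamplingModel
  | withoutReplacement
  | withReplacement

namespace SamplingModel

/-- Probability that a sample of size `m` from an urn with `w` white and `b` black balls
contains exactly `k` white balls: hypergeometric for sampling without replacement,
binomial for sampling with replacement. -/
def drawProb (S : SamplingModel) (m w b k : ℕ) : ℝ :=
  match S with
  | withoutReplacement => ((w.choose k : ℝ) * (b.choose (m - k) : ℝ)) / ((w + b).choose m : ℝ)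
  | withReplacement =>
      (m.choose k : ℝ) * ((w : ℝ) ^ k * (b : ℝ) ^ (m - k)) / ((w : ℝ) + (b : ℝ)) ^ m

end SamplingModel

/-- A balanced two-color urn scheme with multiple drawings: the sample size `m ≥ 1`, the
replacement matrix with rows `(a k, b k)`, `0 ≤ k ≤ m` (values at `k > m` are never used),
the balance `σ ≥ 1`, and the initial numbers `W0`, `B0` of white and black balls, with
`T₀ = W0 + B0 ≥ m`. If the sample contains `k` white balls, then `a (m - k)` white and
`b (m - k)` black balls are added. -/
structure Urn where
  m : ℕ
  a : ℕ → ℤ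
  b : ℕ → ℤ
  σ : ℕ
  W0 : ℕ
  B0 : ℕ
  one_le_m : 1 ≤ m
  one_le_σ : 1 ≤ σ
  balanced : ∀ k ≤ m, a k + b k = σ
  m_le_total : m ≤ W0 + B0

namespace Urn

/-- The total number `T₀` of balls at the start. -/
def T0 (U : Urn) : ℕ := U.W0 + U.B0

/-- The total number `Tₙ = T₀ + σ n` of balls after `n` draws. -/
def T (U : Urn) (n : ℕ) : ℕ := U.T0 + U.σ * n

/-- The coefficient `a_m`, the number of white balls added to the urn after a draw of
`m` black balls. -/
def am (U : Urn) : ℤ := U.a U.m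

/-- The coefficient `a_{m-1}`. -/
def am1 (U : Urn) : ℤ := U.a (U.m - 1)

/-- The urn index `Λ = (m / σ) (a_{m-1} - a_m)`. -/
def Λ (U : Urn) : ℝ := (U.m : ℝ) / (U.σ : ℝ) * ((U.am1 : ℝ) - (U.am : ℝ))

/-- `U.Reachable S n w b`: the urn can contain `w` white and `b` black balls after `n` draws,
each of them having positive probability. -/
inductive Reachable (U : Urn) (S : SamplingModel) : ℕ → ℤ → ℤ → Prop
  | init : Reachable U S 0 U.W0 U.B0
  | step (n : ℕ) (w b : ℤ) (k : ℕ) (h : Reachable U S n w b) (hk : k ≤ U.m)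
      (hp : 0 < S.drawProb U.m w.toNat b.toNat k) :
      Reachable U S (n + 1) (w + U.a (U.m - k)) (b + U.b (U.m - k))

/-- The urn is tenable: drawing and replacing can go on forever, because no color can ever
be asked for more balls than the urn contains. -/
def Tenable (U : Urn) (S : SamplingModel) : Prop :=
  ∀ (n : ℕ) (w b : ℤ), U.Reachable S n w b → 0 ≤ w ∧ 0 ≤ b

/-- The urn is affine: given `w` white balls after `n` draws, the expected number of white
balls after the next draw is `α n * w + β n`, with deterministic `α n`, `β n`. -/
def IsAffine (U : Urn) (S : SamplingModel) : Prop :=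
  ∃ α β : ℕ → ℝ, ∀ n w b : ℕ, w + b = U.T n →
    ∑ k ∈ Finset.range (U.m + 1),
        S.drawProb U.m w b k * ((w : ℝ) + (U.a (U.m - k) : ℝ)) = α n * (w : ℝ) + β n

/-- Large-index urns. -/
def IsLargeIndex (U : Urn) : Prop := 1 / 2 < U.Λ

/-- Triangular urns: `a_m = 0` and `a_{m-1} = c > 0`. -/
def IsTriangular (U : Urn) : Prop := U.am = 0 ∧ 0 < U.am1

section Draws

variable {Ω : Type*}

/-- The number `Wₙ` of white balls after `n` draws, where `K i` is the number of white balls in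
the `(i+1)`-st sample. -/
def white (U : Urn) (K : ℕ → Ω → Fin (U.m + 1)) (n : ℕ) (ω : Ω) : ℤ :=
  U.W0 + ∑ i ∈ Finset.range n, U.a (U.m - (K i ω : ℕ))

/-- The number `Bₙ` of black balls after `n` draws. -/
def black (U : Urn) (K : ℕ → Ω → Fin (U.m + 1)) (n : ℕ) (ω : Ω) : ℤ :=
  U.B0 + ∑ i ∈ Finset.range n, U.b (U.m - (K i ω : ℕ))

/-- The sigma-algebra generated by the first `n` draws. -/
abbrev history (U : Urn) (K : ℕ → Ω → Fin (U.m + 1)) (n : ℕ) : MeasurableSpace Ω :=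
  ⨆ i : Fin n, MeasurableSpace.comap (K i) inferInstance

/-- `K 0, K 1, …` are the successive sample compositions (numbers of white balls in the samples)
of the urn process on the probability space `(Ω, μ)`: given the first `n` draws, the next sample
contains `k` white balls with the probability prescribed by the sampling model for the current
composition of the urn. -/
structure IsDrawSequence (U : Urn) (S : SamplingModel) [MeasurableSpace Ω] (μ : Measure Ω)
    (K : ℕ → Ω → Fin (U.m + 1)) : Prop where
  measurable : ∀ n, Measurable (K n)
  condProb : ∀ (n : ℕ) (k : Fin (U.m + 1)),
    μ⟦K n ⁻¹' {k} | U.history K n⟧ =ᵐ[μ] fun ω =>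
      S.drawProb U.m (U.white K n ω).toNat (U.black K n ω).toNat (k : ℕ)

/-- The shifted number of white balls `Wₙ - (a_m / (1 - Λ)) n`. For `a_m = 0` the quotient is `0`
whatever `Λ` is, also for `Λ = 1`. -/
def shifted (U : Urn) (K : ℕ → Ω → Fin (U.m + 1)) (n : ℕ) (ω : Ω) : ℝ :=
  (U.white K n ω : ℝ) - (U.am : ℝ) / (1 - U.Λ) * (n : ℝ)

end Draws

/-- The coefficient `p_{n;(i,ℓ)}` (for `n ≥ 1`) of `w ^ ℓ` in the `i`-th moment of the number of
white balls in a sample from an urn with `w` white balls among `T_{n-1}` balls. -/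
def p (U : Urn) (S : SamplingModel) (n i ℓ : ℕ) : ℝ :=
  match S with
  | SamplingModel.withoutReplacement =>
      ∑ h ∈ Finset.Icc ℓ (min i U.m),
        (-1 : ℝ) ^ (h - ℓ) * ((Nat.stirlingFirst h ℓ : ℝ) * (Nat.stirlingSecond i h : ℝ)
          * (U.m.choose h : ℝ)) / ((U.T (n - 1)).choose h : ℝ)
  | SamplingModel.withReplacement =>
      (Nat.stirlingSecond i ℓ : ℝ) * (U.m.descFactorial ℓ : ℝ) / (U.T (n - 1) : ℝ) ^ ℓ

/-- The coefficients `f_{n,s,r}`, for `n ≥ 1` and `0 ≤ r ≤ s`. -/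
def f (U : Urn) (S : SamplingModel) (n s r : ℕ) : ℝ :=
  ∑ j ∈ Finset.Icc (s - r) s, (s.choose j : ℝ) * U.Λ ^ j *
    ∑ ℓ ∈ Finset.Icc (j - (s - r)) j, (ℓ.choose (j - (s - r)) : ℝ) *
      ((U.am : ℝ) * ((n : ℝ) - 1) / (1 - U.Λ)) ^ (ℓ + (s - r) - j) *
      ∑ i ∈ Finset.Icc ℓ j, (j.choose i : ℝ) *
        (((U.σ : ℝ) ^ i * (U.am : ℝ) ^ (j - i)) / ((U.m : ℝ) ^ i * (U.Λ - 1) ^ (j - i))) *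
        U.p S n i ℓ

/-- The constant `C = Λ σ / m`. -/
def C (U : Urn) : ℝ := U.Λ * (U.σ : ℝ) / (U.m : ℝ)

/-- `s* = min (s, m)`. -/
def sStar (U : Urn) (s : ℕ) : ℕ := min s U.m

/-- The binomial coefficient `binom (q) k = q (q - 1) ⋯ (q - k + 1) / k!` of a polynomial `q`. -/
def binomPoly (q : ℝ[X]) (k : ℕ) : ℝ[X] :=
  Polynomial.C (1 / (k.factorial : ℝ)) * ∏ i ∈ Finset.range k, (q - Polynomial.C (i : ℝ))

/-- The polynomials `P_s` of the model without replacement. -/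
def P (U : Urn) (s : ℕ) : ℝ[X] :=
  Polynomial.C (((U.sStar s).factorial : ℝ) / (U.σ : ℝ) ^ (U.sStar s)) *
    ∑ ℓ ∈ Finset.range (U.sStar s + 1),
      Polynomial.C ((s.choose ℓ : ℝ) / ((U.sStar s).choose ℓ : ℝ) * U.C ^ ℓ * (U.m.choose ℓ : ℝ)) *
        binomPoly (Polynomial.C (U.σ : ℝ) * Polynomial.X + Polynomial.C ((U.T0 : ℝ) - (ℓ : ℝ)))
          (U.sStar s - ℓ)

/-- The polynomials `Q_s` of the model with replacement. -/
def Q (U : Urn) (s : ℕ) : ℝ[X] :=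
  Polynomial.C (1 / (U.σ : ℝ) ^ s) *
    ∑ ℓ ∈ Finset.range (s + 1),
      Polynomial.C ((s.choose ℓ : ℝ) * U.C ^ ℓ * (U.m.choose ℓ : ℝ) * (ℓ.factorial : ℝ)) *
        (Polynomial.C (U.σ : ℝ) * Polynomial.X + Polynomial.C (U.T0 : ℝ)) ^ (s - ℓ)

/-- The product of `Γ(ν)` over the negated complex roots `ν` of a real polynomial, counted with
multiplicity. -/
def gammaNegRoots (q : ℝ[X]) : ℂ :=
  ((q.aroots ℂ).map fun z => Complex.Gamma (-z)).prod

/-- The `ℓ`-th term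
`(∑_{i<s} f_{ℓ,s,i} E[W̃_{ℓ-1}^i]) / ∏_{j=1}^ℓ f_{j,s,s}`, `ℓ ≥ 1`, of the infinite sum. -/
def term (U : Urn) (S : SamplingModel) {Ω : Type*} [MeasurableSpace Ω] (μ : Measure Ω)
    (K : ℕ → Ω → Fin (U.m + 1)) (s ℓ : ℕ) : ℝ :=
  (∑ i ∈ Finset.range s, U.f S ℓ s i * ∫ ω, (U.shifted K (ℓ - 1) ω) ^ i ∂μ) /
    ∏ j ∈ Finset.Icc 1 ℓ, U.f S j s s

end Urn

end

/-! An affine urn has an affine replacement matrix (`IsAffine.a_eq`): a sample with k white balls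
adds a_m + kC white balls. The increment of the centred process is then Λ(σk/m + a_m/(Λ-1)), and the
moments of k are polynomials in the number of white balls. Hence the conditional s-th moment after
one draw is a polynomial in the present centred value, with coefficients f_{n+1,s,r}
(`sum_drawProb_mul_shifted_pow`). Taking expectations gives a recursion that is triangular in s
(`moment_succ`). Variation of constants solves it: the s-th moment is ∏ f_{j,s,s} times W_0^s plus a
partial sum of Σ_s (`moment_eq_prod_mul`).

Two asymptotic facts remain. First, f_{n+1,s,s} is the value at n of P_s or Q_s divided by explicit
linear factors of the same total degree (`f_self_eq_eval_div`). Euler's limit formula for Γ turns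
the product into a constant times n^{sΛ}, the exponent being the difference of the subleading
coefficients (`tendsto_prod_newtonSum`). In the Newton basis used here all coefficients are
nonnegative, which gives f_{j,s,s} > 0 and excludes the roots 0, 1, 2, ….

Second, Σ_s must converge. If the moments of order i < s are O(n^{iΛ}), it suffices that f_{n,s,r} =
O(n^{(s-r)Λ-ρ}) for r < s with one ρ > 1 (`exists_f_isBigO_rpow`). Power counting always gives O(1),
and gives O(1/n) whenever f_{n,s-r,0} is O(1/n). The centring ensures this for s-r = 1; for s-r ≥ 2
the bound O(1) is enough if Λ > 1/2, while in a triangular urn f_{n,s-r,0} vanishes. Strong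
induction on s closes the argument (`moment_isBigO`). -/

/-! ### Stirling expansions and factorial moments of the drawing weights. -/

theorem Nat.cast_descFactorial_succ_mul (k h : ℕ) :
    (k.descFactorial (h + 1) : ℝ) = k.descFactorial h * ((k : ℝ) - h) := by
  rcases le_or_gt h k with hk | hk
  · rw [Nat.descFactorial_succ, Nat.cast_mul, Nat.cast_sub hk, mul_comm]
  · rw [Nat.descFactorial_of_lt hk, Nat.descFactorial_of_lt (hk.trans (Nat.lt_succ_self h))]
    simp

theorem Nat.cast_pow_eq_sum_stirlingSecond (i k : ℕ) :
    (k : ℝ) ^ i =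
      ∑ h ∈ Finset.range (i + 1), (Nat.stirlingSecond i h : ℝ) * k.descFactorial h := by
  induction i with
  | zero => simp
  | succ i ih =>
    rw [Finset.sum_range_succ']
    simp only [Nat.stirlingSecond_succ_succ, Nat.stirlingSecond_succ_zero, Nat.cast_zero,
      zero_mul, add_zero, Nat.cast_add, Nat.cast_mul, add_mul, Finset.sum_add_distrib]
    -- Index shift without boundary terms: the factor x kills x = 0, and the Stirling number
    -- vanishes at x = i + 1.
    have h1 : ∑ x ∈ Finset.range (i + 1), ((x + 1 : ℕ) : ℝ) * (Nat.stirlingSecond i (x + 1) : ℝ) *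
        k.descFactorial (x + 1) = ∑ x ∈ Finset.range (i + 1), (x : ℝ) * Nat.stirlingSecond i x *
        k.descFactorial x := by
      have := Finset.sum_range_succ' (fun x : ℕ => (x : ℝ) * (Nat.stirlingSecond i x : ℝ) *
        k.descFactorial x) (i + 1)
      rw [Finset.sum_range_succ] at this
      simpa [Nat.stirlingSecond_eq_zero_of_lt (Nat.lt_succ_self i)] using this.symm
    have h2 : ∑ x ∈ Finset.range (i + 1), (x : ℝ) * (Nat.stirlingSecond i (x + 1) : ℝ) *
        k.descFactorial (x + 1) + ∑ x ∈ Finset.range (i + 1), ((1 : ℕ) : ℝ) *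
        (Nat.stirlingSecond i (x + 1) : ℝ) * k.descFactorial (x + 1) =
        ∑ x ∈ Finset.range (i + 1), (x : ℝ) * Nat.stirlingSecond i x * k.descFactorial x := by
      rw [← h1, ← Finset.sum_add_distrib]
      exact Finset.sum_congr rfl fun x _ => by push_cast; ring
    rw [h2, pow_succ, ih, Finset.sum_mul, ← Finset.sum_add_distrib]
    refine Finset.sum_congr rfl fun x _ => ?_
    rw [Nat.cast_descFactorial_succ_mul]
    ring

theorem Nat.cast_descFactorial_eq_sum_stirlingFirst (h w : ℕ) :
    (w.descFactorial h : ℝ) =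
      ∑ l ∈ Finset.range (h + 1), (-1 : ℝ) ^ (h - l) * Nat.stirlingFirst h l * (w : ℝ) ^ l := by
  induction h with
  | zero => simp
  | succ h ih =>
    rw [Finset.sum_range_succ', Nat.cast_descFactorial_succ_mul, ih]
    simp only [Nat.stirlingFirst_succ_succ, Nat.stirlingFirst_succ_zero, Nat.cast_zero,
      mul_zero, zero_mul, add_zero, Nat.add_sub_add_right]
    have h1 : ∑ x ∈ Finset.range (h + 1), (-1 : ℝ) ^ (h - x) * ((h : ℝ) *
        (Nat.stirlingFirst h (x + 1) : ℝ)) * (w : ℝ) ^ (x + 1) =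
        - ∑ x ∈ Finset.range (h + 1), (h : ℝ) * ((-1 : ℝ) ^ (h - x) *
          (Nat.stirlingFirst h x : ℝ) * (w : ℝ) ^ x) := by
      have := Finset.sum_range_succ' (fun x : ℕ => (h : ℝ) * ((-1 : ℝ) ^ (h - x) *
          (Nat.stirlingFirst h x : ℝ) * (w : ℝ) ^ x)) h
      rw [this, Finset.sum_range_succ, Nat.stirlingFirst_eq_zero_of_lt (Nat.lt_succ_self h)]
      -- The boundary term of the shift: either h = 0 or the Stirling number is zero.
      have h0 : (h : ℝ) * (Nat.stirlingFirst h 0 : ℝ) = 0 := by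
        cases h <;> simp
      have h0' : (h : ℝ) * ((-1 : ℝ) ^ (h - 0) * (Nat.stirlingFirst h 0 : ℝ) * (w : ℝ) ^ 0) = 0 := by
        linear_combination (-1 : ℝ) ^ (h - 0) * (w : ℝ) ^ 0 * h0
      rw [h0', add_zero, ← Finset.sum_neg_distrib]
      simp only [Nat.cast_zero, mul_zero, zero_mul, add_zero]
      refine Finset.sum_congr rfl fun x hx => ?_
      have hx' : h - x = (h - (x + 1)) + 1 := by
        have := Finset.mem_range.1 hx
        omega
      rw [hx', pow_succ]
      ring
    simp only [Nat.cast_add, Nat.cast_mul, mul_add, add_mul, Finset.sum_add_distrib]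
    rw [h1, Finset.sum_mul, ← Finset.sum_neg_distrib, ← Finset.sum_add_distrib]
    refine Finset.sum_congr rfl fun x _ => ?_
    ring

/-- Double counting: a k-subset with an ordered h-tuple inside it can be built by picking the tuple
first. This absorption makes the factorial moments of both models summable in closed form. -/
theorem Nat.choose_mul_descFactorial (w k h : ℕ) (hk : h ≤ k) :
    w.choose k * k.descFactorial h = w.descFactorial h * (w - h).choose (k - h) := by
  rcases le_or_gt k w with hw | hw
  · have h1 := Nat.choose_mul (n := w) hk
    rw [Nat.descFactorial_eq_factorial_mul_choose, Nat.descFactorial_eq_factorial_mul_choose]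
    linear_combination h.factorial * h1
  · rw [Nat.choose_eq_zero_of_lt hw]
    rcases le_or_gt h w with hh | hh
    · rw [Nat.choose_eq_zero_of_lt (by omega : w - h < k - h)]
      simp
    · rw [Nat.descFactorial_of_lt hh]
      simp

/-- Factorial moments of the hypergeometric weights. -/
theorem Nat.sum_choose_mul_choose_mul_descFactorial (m w b h : ℕ) (hm : h ≤ m) (hw : h ≤ w) :
    ∑ k ∈ Finset.range (m + 1), w.choose k * b.choose (m - k) * k.descFactorial h =
      w.descFactorial h * (w + b - h).choose (m - h) := by
  obtain ⟨m, rfl⟩ := Nat.exists_eq_add_of_le hm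
  rw [show h + m + 1 = h + (m + 1) by ring, Finset.sum_range_add]
  rw [Finset.sum_eq_zero (fun k hk => by
    rw [Nat.descFactorial_of_lt (Finset.mem_range.1 hk), mul_zero]), zero_add]
  -- After absorption of the falling factorial, what remains is Vandermonde's convolution for w - h
  -- and b.
  rw [show w + b - h = (w - h) + b by omega, Nat.add_sub_cancel_left, Nat.add_choose_eq,
    Finset.Nat.sum_antidiagonal_eq_sum_range_succ_mk, Finset.mul_sum]
  refine Finset.sum_congr rfl fun k _ => ?_
  have := Nat.choose_mul_descFactorial w (h + k) h (by omega)
  rw [Nat.add_sub_cancel_left] at this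
  rw [Nat.add_sub_add_left]
  simp only
  linear_combination (b.choose (m - k)) * this

/-- Factorial moments of the binomial weights. -/
theorem Nat.sum_choose_mul_pow_mul_descFactorial (m h : ℕ) (w b : ℝ) (hm : h ≤ m) :
    ∑ k ∈ Finset.range (m + 1), (m.choose k : ℝ) * (w ^ k * b ^ (m - k)) * k.descFactorial h =
      m.descFactorial h * w ^ h * (w + b) ^ (m - h) := by
  obtain ⟨m, rfl⟩ := Nat.exists_eq_add_of_le hm
  rw [show h + m + 1 = h + (m + 1) by ring, Finset.sum_range_add]
  rw [Finset.sum_eq_zero (fun k hk => by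
    rw [Nat.descFactorial_of_lt (Finset.mem_range.1 hk), Nat.cast_zero, mul_zero]), zero_add]
  rw [Nat.add_sub_cancel_left, add_pow, Finset.mul_sum]
  refine Finset.sum_congr rfl fun k _ => ?_
  have := Nat.choose_mul_descFactorial (h + m) (h + k) h (by omega)
  rw [Nat.add_sub_cancel_left, Nat.add_sub_cancel_left] at this
  have : ((h + m).choose (h + k) : ℝ) * (h + k).descFactorial h =
    (h + m).descFactorial h * m.choose k := by exact_mod_cast this
  rw [Nat.add_sub_add_left, pow_add]
  linear_combination w ^ h * w ^ k * b ^ (m - k) * this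

/-! ### Factorial moments and support of a sample. -/

namespace SamplingModel

theorem drawProb_nonneg (S : SamplingModel) (m w b k : ℕ) : 0 ≤ S.drawProb m w b k := by
  cases S <;> simp only [drawProb] <;> positivity

theorem sum_drawProb_mul_descFactorial_withoutReplacement (m w b h : ℕ) (hm : m ≤ w + b) :
    ∑ k ∈ Finset.range (m + 1), withoutReplacement.drawProb m w b k * k.descFactorial h =
      m.choose h * w.descFactorial h / (w + b).choose h := by
  simp only [drawProb]
  rcases lt_or_ge m h with hh | hh
  · rw [Nat.choose_eq_zero_of_lt hh, Finset.sum_eq_zero]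
    · simp
    · intro k hk
      rw [Nat.descFactorial_of_lt ((Nat.lt_succ_iff.1 (Finset.mem_range.1 hk)).trans_lt hh)]
      simp
  rcases lt_or_ge w h with hw | hw
  · rw [Nat.descFactorial_of_lt hw, Finset.sum_eq_zero]
    · simp
    · intro k hk
      rcases lt_or_ge k h with hk | hk
      · rw [Nat.descFactorial_of_lt hk]; simp
      · rw [Nat.choose_eq_zero_of_lt (hw.trans_le hk)]; simp
  have h1 := Nat.sum_choose_mul_choose_mul_descFactorial m w b h hh hw
  have h2 := Nat.choose_mul (n := w + b) hh
  have h1' : ∑ k ∈ Finset.range (m + 1), (w.choose k : ℝ) * b.choose (m - k) * k.descFactorial h =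
      w.descFactorial h * (w + b - h).choose (m - h) := by exact_mod_cast h1
  have h2' : ((w + b).choose m : ℝ) * m.choose h =
    (w + b).choose h * (w + b - h).choose (m - h) := by exact_mod_cast h2
  have hp1 : ((w + b).choose m : ℝ) ≠ 0 := by exact_mod_cast (Nat.choose_pos hm).ne'
  have hp2 : ((w + b).choose h : ℝ) ≠ 0 := by exact_mod_cast (Nat.choose_pos (hh.trans hm)).ne'
  rw [eq_div_iff hp2]
  simp_rw [div_mul_eq_mul_div]
  rw [← Finset.sum_div, h1', div_mul_eq_mul_div, div_eq_iff hp1]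
  linear_combination -(w.descFactorial h : ℝ) * h2'

theorem sum_drawProb_mul_descFactorial_withReplacement (m w b h : ℕ) (hm : 0 < w + b) :
    ∑ k ∈ Finset.range (m + 1), withReplacement.drawProb m w b k * k.descFactorial h =
      m.descFactorial h * (w : ℝ) ^ h / ((w : ℝ) + b) ^ h := by
  simp only [drawProb]
  rcases lt_or_ge m h with hh | hh
  · rw [Nat.descFactorial_of_lt hh, Finset.sum_eq_zero]
    · simp
    · intro k hk
      rw [Nat.descFactorial_of_lt ((Nat.lt_succ_iff.1 (Finset.mem_range.1 hk)).trans_lt hh)]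
      simp
  have hp : ((w : ℝ) + b) ≠ 0 := by exact_mod_cast hm.ne'
  simp_rw [div_mul_eq_mul_div]
  rw [← Finset.sum_div, Nat.sum_choose_mul_pow_mul_descFactorial m h _ _ hh,
    div_eq_div_iff (pow_ne_zero _ hp) (pow_ne_zero _ hp), mul_assoc, ← pow_add,
    Nat.sub_add_cancel hh]

/-- The sample with as many white balls as possible can occur in both models. It is used to steer
the urn along extreme paths. With replacement, an absent color enters as 0^0 = 1. -/
theorem drawProb_min_pos (S : SamplingModel) {m w b : ℕ} (hm : m ≤ w + b) :
    0 < S.drawProb m w b (min w m) := by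
  have hT : 0 < (w + b).choose m := Nat.choose_pos hm
  have hW : 0 < w.choose (min w m) := Nat.choose_pos (min_le_left _ _)
  have hB : 0 < b.choose (m - min w m) := Nat.choose_pos (by omega)
  have hM : 0 < m.choose (min w m) := Nat.choose_pos (min_le_right _ _)
  have hw : 0 < w ^ min w m := by
    rcases Nat.eq_zero_or_pos w with h | h
    · simp [h]
    · positivity
  have hb : 0 < b ^ (m - min w m) := by
    rcases Nat.eq_zero_or_pos b with h | h
    · subst h
      simp [show m - min w m = 0 by omega]
    · positivity
  have hs : 0 < (w + b) ^ m := by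
    rcases Nat.eq_zero_or_pos (w + b) with h | h
    · simp [h, show m = 0 by omega]
    · positivity
  cases S <;> simp only [drawProb]
  · positivity
  · refine div_pos (mul_pos ?_ (mul_pos ?_ ?_)) ?_ <;> exact_mod_cast ‹_›

theorem drawProb_symm (S : SamplingModel) {m w b k : ℕ} (hk : k ≤ m) :
    S.drawProb m w b (m - k) = S.drawProb m b w k := by
  cases S <;> simp only [drawProb, Nat.sub_sub_self hk, Nat.choose_symm hk]
  · rw [mul_comm, add_comm]
  · rw [mul_comm ((w : ℝ) ^ _), add_comm]

end SamplingModel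

/-! ### Moments of a sample, and affinity of the replacement matrix. -/

namespace Urn

theorem m_le_T (U : Urn) (n : ℕ) : U.m ≤ U.T n :=
  U.m_le_total.trans (Nat.le_add_right _ _)

theorem T_pos (U : Urn) (n : ℕ) : 0 < U.T n := U.one_le_m.trans (U.m_le_T n)

/-- The moments of a sample composition. -/
theorem sum_drawProb_mul_pow (U : Urn) (S : SamplingModel) (n w b i : ℕ) (hT : w + b = U.T n) :
    ∑ k ∈ Finset.range (U.m + 1), S.drawProb U.m w b k * (k : ℝ) ^ i =
      ∑ l ∈ Finset.range (i + 1), U.p S (n + 1) i l * (w : ℝ) ^ l := by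
  have hm : U.m ≤ w + b := hT ▸ U.m_le_T n
  have h1 : ∑ k ∈ Finset.range (U.m + 1), S.drawProb U.m w b k * (k : ℝ) ^ i =
      ∑ h ∈ Finset.range (i + 1), (Nat.stirlingSecond i h : ℝ) *
        ∑ k ∈ Finset.range (U.m + 1), S.drawProb U.m w b k * k.descFactorial h := by
    simp_rw [Nat.cast_pow_eq_sum_stirlingSecond, Finset.mul_sum]
    rw [Finset.sum_comm]
    refine Finset.sum_congr rfl fun h _ => Finset.sum_congr rfl fun k _ => ?_
    ring
  rw [h1]
  cases S with
  | withoutReplacement =>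
    simp only [SamplingModel.sum_drawProb_mul_descFactorial_withoutReplacement _ _ _ _ hm, p]
    simp only [Nat.add_sub_cancel, hT, Nat.cast_descFactorial_eq_sum_stirlingFirst, Finset.sum_mul,
      Finset.mul_sum, Finset.sum_div]
    have h2 : ∀ l, Finset.Icc l (min i U.m) ⊆ Finset.Icc l i := fun l =>
      Finset.Icc_subset_Icc le_rfl (min_le_left _ _)
    rw [Finset.sum_comm' (s' := fun l => Finset.Icc l i) (t' := Finset.range (i + 1))]
    · refine Finset.sum_congr rfl fun l _ => ?_
      symm
      refine (Finset.sum_subset (h2 l) fun h h3 h4 => ?_).trans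
        (Finset.sum_congr rfl fun h _ => ?_)
      · simp only [Finset.mem_Icc, le_min_iff, not_and, not_le] at h3 h4
        rw [Nat.choose_eq_zero_of_lt (h4 h3.1 h3.2)]
        simp
      · ring
    · intro h l
      simp only [Finset.mem_range, Finset.mem_Icc]
      omega
  | withReplacement =>
    have hm' : 0 < w + b := hT ▸ U.T_pos n
    simp only [SamplingModel.sum_drawProb_mul_descFactorial_withReplacement _ _ _ _ hm', p,
      Nat.add_sub_cancel, ← hT, Nat.cast_add]
    refine Finset.sum_congr rfl fun l _ => ?_
    ring

theorem sum_drawProb (S : SamplingModel) (m w b : ℕ) (hm : m ≤ w + b) (h0 : 0 < w + b) :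
    ∑ k ∈ Finset.range (m + 1), S.drawProb m w b k = 1 := by
  cases S
  · simpa using SamplingModel.sum_drawProb_mul_descFactorial_withoutReplacement m w b 0 hm
  · simpa using SamplingModel.sum_drawProb_mul_descFactorial_withReplacement m w b 0 h0

theorem sum_drawProb_mul_self (S : SamplingModel) (m w b : ℕ) (hm : m ≤ w + b) (h0 : 0 < w + b) :
    ∑ k ∈ Finset.range (m + 1), S.drawProb m w b k * (k : ℝ) =
      m * (w : ℝ) / ((w + b : ℕ) : ℝ) := by
  cases S
  · simpa using SamplingModel.sum_drawProb_mul_descFactorial_withoutReplacement m w b 1 hm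
  · simpa using SamplingModel.sum_drawProb_mul_descFactorial_withReplacement m w b 1 h0

/-- A function of the sample composition whose expectation vanishes for every composition of the
urn is zero. -/
theorem eq_zero_of_sum_drawProb_eq_zero (S : SamplingModel) {m T : ℕ} (hT : m ≤ T) (h0 : 0 < T)
    (g : ℕ → ℝ)
    (hg : ∀ w b, w + b = T → ∑ k ∈ Finset.range (m + 1), S.drawProb m w b k * g k = 0) :
    ∀ k ≤ m, g k = 0 := by
  cases S with
  | withoutReplacement =>
    intro k
    induction k using Nat.strong_induction_on with
    | _ k ih =>
      intro hk
      -- With exactly k white balls in the urn, samples with more than k white balls are impossible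
      -- and those with fewer are covered by induction, so only the k-th term survives.
      have h1 := hg k (T - k) (by omega)
      rw [Finset.sum_eq_single k] at h1
      · refine (mul_eq_zero.1 h1).resolve_left ?_
        have h2 : 0 < (T - k).choose (m - k) := Nat.choose_pos (by omega)
        have h3 : 0 < (k + (T - k)).choose m := Nat.choose_pos (by omega)
        simp only [SamplingModel.drawProb, Nat.choose_self]
        positivity
      · intro j hj hjk
        rcases lt_or_gt_of_ne hjk with h | h
        · rw [ih j h (by omega), mul_zero]
        · simp [SamplingModel.drawProb, Nat.choose_eq_zero_of_lt h]
      · intro h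
        exact absurd (Finset.mem_range.2 (by omega)) h
  | withReplacement =>
    have hT0 : (T : ℝ) ≠ 0 := by exact_mod_cast h0.ne'
    have key : ∀ w b, w + b = T → ∑ k ∈ Finset.range (m + 1),
        (m.choose k : ℝ) * ((w : ℝ) ^ k * (b : ℝ) ^ (m - k)) * g k = 0 := by
      intro w b hwb
      have := hg w b hwb
      simp only [SamplingModel.drawProb, ← Nat.cast_add, hwb, div_mul_eq_mul_div] at this
      rw [← Finset.sum_div, div_eq_zero_iff] at this
      exact this.resolve_right (pow_ne_zero _ hT0)
    -- An urn without black balls isolates the top term. Removing it leaves a polynomial of degree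
    -- below m.
    have hgm : g m = 0 := by
      have := key T 0 (by simp)
      rw [Finset.sum_range_succ, Finset.sum_eq_zero] at this
      · simpa [hT0] using this
      · intro k hk
        have : m - k ≠ 0 := by
          have := Finset.mem_range.1 hk
          omega
        simp [this]
    -- Dividing the identity by b^m makes it polynomial in w/b. The m values w = 0, …, m-1, for
    -- which b = T - w > 0, give m distinct zeros.
    let G : ℝ[X] := ∑ k ∈ Finset.range m, Polynomial.C ((m.choose k : ℝ) * g k) * Polynomial.X ^ k
    have hcoeff : ∀ k < m, G.coeff k = (m.choose k : ℝ) * g k := by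
      intro k hk
      simp only [G, Polynomial.finsetSum_coeff, Polynomial.coeff_C_mul_X_pow]
      rw [Finset.sum_ite_eq, if_pos (Finset.mem_range.2 hk)]
    have hG : G = 0 := by
      rcases Nat.eq_zero_or_pos m with h | h
      · subst h
        simp [G]
      refine Polynomial.eq_zero_of_degree_lt_of_eval_finset_eq_zero
        ((Finset.range m).image fun w : ℕ => (w : ℝ) / ((T : ℝ) - w)) ?_ ?_
      · rw [Finset.card_image_of_injOn, Finset.card_range]
        · refine (Polynomial.degree_sum_le _ _).trans_lt ?_
          rw [Finset.sup_lt_iff (by simp)]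
          intro k hk
          refine (Polynomial.degree_C_mul_X_pow_le _ _).trans_lt ?_
          exact_mod_cast Finset.mem_range.1 hk
        · intro x hx y hy hxy
          simp only [Finset.coe_range, Set.mem_Iio] at hx hy
          have hx' : (T : ℝ) - x ≠ 0 := sub_ne_zero.2 (by exact_mod_cast (by omega : T ≠ x))
          have hy' : (T : ℝ) - y ≠ 0 := sub_ne_zero.2 (by exact_mod_cast (by omega : T ≠ y))
          simp only at hxy
          rw [div_eq_div_iff hx' hy'] at hxy
          have : (T : ℝ) * ((x : ℝ) - y) = 0 := by linear_combination hxy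
          have := (mul_eq_zero.1 this).resolve_left hT0
          exact_mod_cast sub_eq_zero.1 this
      · intro x hx
        obtain ⟨w, hw, rfl⟩ := Finset.mem_image.1 hx
        have hw := Finset.mem_range.1 hw
        have h1 := key w (T - w) (by omega)
        rw [Finset.sum_range_succ, hgm, mul_zero, add_zero, Nat.cast_sub (by omega)] at h1
        have hx' : (T : ℝ) - w ≠ 0 := sub_ne_zero.2 (by exact_mod_cast (by omega : T ≠ w))
        have h2 : ((T : ℝ) - w) ^ m * G.eval ((w : ℝ) / ((T : ℝ) - w)) = 0 := by
          rw [← h1]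
          simp only [G, Polynomial.eval_finsetSum, Polynomial.eval_mul, Polynomial.eval_C,
            Polynomial.eval_pow, Polynomial.eval_X, Finset.mul_sum]
          refine Finset.sum_congr rfl fun k hk => ?_
          have hk := Finset.mem_range.1 hk
          obtain ⟨d, rfl⟩ := Nat.exists_eq_add_of_le hk.le
          rw [Nat.add_sub_cancel_left, div_pow, pow_add]
          field_simp
        exact (mul_eq_zero.1 h2).resolve_left (pow_ne_zero _ hx')
    intro k hk
    rcases hk.lt_or_eq with h | h
    · have h1 := hcoeff k h
      rw [hG, Polynomial.coeff_zero] at h1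
      refine (mul_eq_zero.1 h1.symm).resolve_left ?_
      exact_mod_cast (Nat.choose_pos hk).ne'
    · rw [h, hgm]

/-- An affine urn has an affine replacement matrix. -/
theorem IsAffine.a_eq {U : Urn} {S : SamplingModel} (h : U.IsAffine S) {k : ℕ} (hk : k ≤ U.m) :
    U.a (U.m - k) = U.am + k * (U.am1 - U.am) := by
  obtain ⟨α, β, hαβ⟩ := h
  have hT : (U.T 0 : ℝ) ≠ 0 := by exact_mod_cast (U.T_pos 0).ne'
  have hm : (U.m : ℝ) ≠ 0 := by exact_mod_cast (Nat.pos_iff_ne_zero.1 U.one_le_m)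
  -- The mean of k is m w/T_0, so (α_0 - 1)w is itself the mean of a multiple of k. Affinity at time
  -- 0 thus says that this function of k has mean zero for every composition.
  have key := eq_zero_of_sum_drawProb_eq_zero S (U.m_le_T 0) (U.T_pos 0)
    (fun k => (U.a (U.m - k) : ℝ) - β 0 - (α 0 - 1) * U.T 0 / U.m * k) (by
      intro w b hwb
      have h1 := hαβ 0 w b hwb
      have hs := sum_drawProb S U.m w b (hwb ▸ U.m_le_T 0) (hwb ▸ U.T_pos 0)
      have hs1 := sum_drawProb_mul_self S U.m w b (hwb ▸ U.m_le_T 0) (hwb ▸ U.T_pos 0)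
      have h2 : ∑ k ∈ Finset.range (U.m + 1), S.drawProb U.m w b k *
          ((U.a (U.m - k) : ℝ) - β 0 - (α 0 - 1) * U.T 0 / U.m * k) =
          ∑ k ∈ Finset.range (U.m + 1), S.drawProb U.m w b k * ((w : ℝ) + (U.a (U.m - k) : ℝ)) -
          (w + β 0) * ∑ k ∈ Finset.range (U.m + 1), S.drawProb U.m w b k -
          (α 0 - 1) * U.T 0 / U.m * ∑ k ∈ Finset.range (U.m + 1), S.drawProb U.m w b k * (k : ℝ) := by
        rw [Finset.mul_sum, Finset.mul_sum, ← Finset.sum_sub_distrib, ← Finset.sum_sub_distrib]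
        exact Finset.sum_congr rfl fun k _ => by ring
      rw [h2, h1, hs, hs1, hwb]
      field_simp
      ring)
  have e0 := key 0 (Nat.zero_le _)
  have e1 := key 1 U.one_le_m
  have ek := key k hk
  simp only [Nat.sub_zero, Nat.cast_zero, Nat.cast_one] at e0 e1
  have : (U.a (U.m - k) : ℝ) = U.am + k * (U.am1 - U.am) := by
    simp only [am, am1]
    linear_combination ek - e0 - k * (e1 - e0)
  exact_mod_cast this

end Urn

/-! ### Reachable configurations and the case of index one. -/

namespace Urn

theorem C_eq (U : Urn) : U.C = (U.am1 : ℝ) - U.am := by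
  have hm : (U.m : ℝ) ≠ 0 := by exact_mod_cast (Nat.pos_iff_ne_zero.1 U.one_le_m)
  have hσ : (U.σ : ℝ) ≠ 0 := by exact_mod_cast (Nat.pos_iff_ne_zero.1 U.one_le_σ)
  simp only [C, Λ]
  field_simp

theorem Λ_eq (U : Urn) : U.Λ = U.m / U.σ * U.C := by
  rw [C_eq, Λ]

theorem C_pos (U : Urn) (h : U.IsLargeIndex ∨ U.IsTriangular) : 0 < U.C := by
  have hm : (0 : ℝ) < U.m := by exact_mod_cast U.one_le_m
  have hσ : (0 : ℝ) < U.σ := by exact_mod_cast U.one_le_σ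
  rcases h with h | ⟨h1, h2⟩
  · have : 0 < U.Λ := lt_trans (by norm_num) h
    unfold C
    positivity
  · rw [C_eq, h1]
    simpa using h2

theorem Λ_pos (U : Urn) (h : U.IsLargeIndex ∨ U.IsTriangular) : 0 < U.Λ := by
  have hm : (0 : ℝ) < U.m := by exact_mod_cast U.one_le_m
  have hσ : (0 : ℝ) < U.σ := by exact_mod_cast U.one_le_σ
  have := U.C_pos h
  rw [Λ_eq]
  positivity

theorem Reachable.add_eq {U : Urn} {S : SamplingModel} {n : ℕ} {w b : ℤ}
    (h : U.Reachable S n w b) : w + b = U.T n := by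
  induction h with
  | init => simp [T, T0]
  | step n w b k _ hk _ ih =>
    have := U.balanced (U.m - k) (Nat.sub_le _ _)
    simp only [T, T0, Nat.cast_add, Nat.cast_mul] at ih ⊢
    push_cast
    linarith

theorem Reachable.exists_nat {U : Urn} {S : SamplingModel} (hT : U.Tenable S) {n : ℕ} {w b : ℤ}
    (h : U.Reachable S n w b) : ∃ w' b' : ℕ, w = w' ∧ b = b' ∧ w' + b' = U.T n := by
  obtain ⟨hw, hb⟩ := hT n w b h
  refine ⟨w.toNat, b.toNat, (Int.toNat_of_nonneg hw).symm, (Int.toNat_of_nonneg hb).symm, ?_⟩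
  have := h.add_eq
  omega

theorem Reachable.step_white {U : Urn} {S : SamplingModel} (hT : U.Tenable S) {n : ℕ} {w b : ℤ}
    (h : U.Reachable S n w b) : U.Reachable S (n + 1) (w + U.a (U.m - min w.toNat U.m))
      (b + U.b (U.m - min w.toNat U.m)) := by
  refine .step n w b _ h (min_le_right _ _) (S.drawProb_min_pos ?_)
  obtain ⟨w', b', rfl, rfl, h'⟩ := h.exists_nat hT
  simpa [h'] using U.m_le_T n

theorem Reachable.step_black {U : Urn} {S : SamplingModel} (hT : U.Tenable S) {n : ℕ} {w b : ℤ}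
    (h : U.Reachable S n w b) : U.Reachable S (n + 1) (w + U.a (min b.toNat U.m))
      (b + U.b (min b.toNat U.m)) := by
  have hle : min b.toNat U.m ≤ U.m := min_le_right _ _
  have := Reachable.step n w b (U.m - min b.toNat U.m) h (Nat.sub_le _ _) (by
    rw [S.drawProb_symm hle]
    refine S.drawProb_min_pos ?_
    obtain ⟨w', b', rfl, rfl, h'⟩ := h.exists_nat hT
    have := U.m_le_T n
    simp only [Int.toNat_natCast]
    omega)
  rwa [Nat.sub_sub_self hle] at this

theorem a_eq_of_le {U : Urn} {S : SamplingModel} (h : U.IsAffine S) {k : ℕ} (hk : k ≤ U.m) :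
    U.a k = U.am + (U.m - k : ℤ) * (U.am1 - U.am) := by
  have := h.a_eq (Nat.sub_le U.m k)
  rwa [Nat.sub_sub_self hk, Nat.cast_sub hk] at this

/-- A tenable affine urn of index one is triangular. -/
theorem am_eq_zero_of_Λ_eq_one {U : Urn} {S : SamplingModel} (hT : U.Tenable S)
    (hA : U.IsAffine S) (hΛ : U.Λ = 1) : U.am = 0 := by
  have hm0 : (U.m : ℝ) ≠ 0 := by exact_mod_cast (Nat.pos_iff_ne_zero.1 U.one_le_m)
  have hσ0 : (U.σ : ℝ) ≠ 0 := by exact_mod_cast (Nat.pos_iff_ne_zero.1 U.one_le_σ)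
  have hmC : (U.m : ℤ) * (U.am1 - U.am) = U.σ := by
    have : (U.m : ℝ) * (U.am1 - U.am) = U.σ := by
      rw [Λ, div_mul_eq_mul_div, div_eq_one_iff_eq hσ0] at hΛ
      exact hΛ
    exact_mod_cast this
  have hC : 0 ≤ U.am1 - U.am := by
    have h1 : (0 : ℤ) < U.m := by exact_mod_cast U.one_le_m
    have h2 : (0 : ℤ) ≤ U.σ := by positivity
    by_contra! h
    have := mul_neg_of_pos_of_neg h1 h
    omega
  have ha : ∀ k ≤ U.m, U.am ≤ U.a k := by
    intro k hk
    have hk' : (0 : ℤ) ≤ U.m - k := by exact_mod_cast Int.sub_nonneg.2 (Int.ofNat_le.2 hk)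
    rw [a_eq_of_le hA hk]
    nlinarith [mul_nonneg hk' hC]
  have hb : ∀ k ≤ U.m, -U.am ≤ U.b k := by
    intro k hk
    have h1 := U.balanced k hk
    rw [a_eq_of_le hA hk] at h1
    have hk' : (0 : ℤ) ≤ k := by positivity
    nlinarith [mul_nonneg hk' hC]
  have hb0 : U.b 0 = -U.am := by
    have h1 := U.balanced 0 (Nat.zero_le _)
    rw [a_eq_of_le hA (Nat.zero_le _)] at h1
    push_cast at h1
    linarith
  -- Here Λ = 1 gives a_k ≥ a_m and b_k ≥ -a_m, with equality for b_0. If a_m < 0, black balls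
  -- increase at every draw until there are at least m; then all-black samples stay possible forever
  -- and each removes white balls, against tenability. If a_m > 0, the colors exchange roles.
  rcases lt_trichotomy U.am 0 with h | h | h
  · exfalso
    have h1 : ∀ n, ∃ w b, U.Reachable S n w b ∧ (n : ℤ) ≤ b := by
      intro n
      induction n with
      | zero => exact ⟨_, _, .init, by simp⟩
      | succ n ih =>
        obtain ⟨w, b, hr, hn⟩ := ih
        refine ⟨_, _, hr.step_black hT, ?_⟩
        have := hb (min b.toNat U.m) (min_le_right _ _)
        push_cast
        linarith
    obtain ⟨w, b, hr, hn⟩ := h1 U.m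
    have h2 : ∀ j : ℕ, ∃ w' b', U.Reachable S (U.m + j) w' b' ∧ (U.m : ℤ) ≤ b' ∧ w' ≤ w - j := by
      intro j
      induction j with
      | zero => exact ⟨_, _, hr, hn, by simp⟩
      | succ j ih =>
        obtain ⟨w', b', hr', hn', hw'⟩ := ih
        have hs := hr'.step_black hT
        rw [show min b'.toNat U.m = U.m by omega] at hs
        refine ⟨_, _, hs, ?_, ?_⟩
        · have := hb U.m le_rfl
          linarith
        · have : U.a U.m = U.am := rfl
          push_cast
          linarith
    obtain ⟨w', b', hr', -, hw'⟩ := h2 (w.toNat + 1)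
    have := (hT _ _ _ hr').1
    omega
  · exact h
  · exfalso
    have h1 : ∀ n, ∃ w b, U.Reachable S n w b ∧ (n : ℤ) ≤ w := by
      intro n
      induction n with
      | zero => exact ⟨_, _, .init, by simp⟩
      | succ n ih =>
        obtain ⟨w, b, hr, hn⟩ := ih
        refine ⟨_, _, hr.step_white hT, ?_⟩
        have := ha (U.m - min w.toNat U.m) (Nat.sub_le _ _)
        push_cast
        linarith
    obtain ⟨w, b, hr, hn⟩ := h1 U.m
    have h2 : ∀ j : ℕ, ∃ w' b', U.Reachable S (U.m + j) w' b' ∧ (U.m : ℤ) ≤ w' ∧ b' ≤ b - j := by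
      intro j
      induction j with
      | zero => exact ⟨_, _, hr, hn, by simp⟩
      | succ j ih =>
        obtain ⟨w', b', hr', hn', hw'⟩ := ih
        have hs := hr'.step_white hT
        rw [show U.m - min w'.toNat U.m = 0 by omega] at hs
        refine ⟨_, _, hs, ?_, ?_⟩
        · have := ha 0 (Nat.zero_le _)
          linarith
        · push_cast
          linarith
    obtain ⟨w', b', hr', -, hw'⟩ := h2 (b.toNat + 1)
    have := (hT _ _ _ hr').2
    omega

/-! ### The urn process: measurability and integration over the next draw. -/

/-- The composition is a function of n draws, each with finitely many values. Hence every function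
of it is bounded, and integrability is automatic. -/
theorem finite_range_composition (U : Urn) {Ω : Type*} (K : ℕ → Ω → Fin (U.m + 1)) (n : ℕ) :
    (Set.range fun ω => (U.white K n ω, U.black K n ω)).Finite := by
  refine (Set.finite_range fun v : Fin n → Fin (U.m + 1) =>
    ((U.W0 + ∑ i, U.a (U.m - (v i : ℕ)) : ℤ), (U.B0 + ∑ i, U.b (U.m - (v i : ℕ)) : ℤ))).subset ?_
  rintro _ ⟨ω, rfl⟩
  exact ⟨fun i => K i ω, by simp only [white, black, Finset.sum_range]⟩

theorem white_succ (U : Urn) {Ω : Type*} (K : ℕ → Ω → Fin (U.m + 1)) (n : ℕ) (ω : Ω) :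
    U.white K (n + 1) ω = U.white K n ω + U.a (U.m - (K n ω : ℕ)) := by
  simp only [white, Finset.sum_range_succ, add_assoc]

theorem black_succ (U : Urn) {Ω : Type*} (K : ℕ → Ω → Fin (U.m + 1)) (n : ℕ) (ω : Ω) :
    U.black K (n + 1) ω = U.black K n ω + U.b (U.m - (K n ω : ℕ)) := by
  simp only [black, Finset.sum_range_succ, add_assoc]

theorem measurable_history (U : Urn) {Ω : Type*} (K : ℕ → Ω → Fin (U.m + 1)) {n i : ℕ}
    (hi : i < n) : Measurable[U.history K n] (K i) :=
  Measurable.mono (comap_measurable (K i)) (le_iSup (fun j : Fin n =>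
    MeasurableSpace.comap (K j) inferInstance) ⟨i, hi⟩) le_rfl

theorem measurable_white (U : Urn) {Ω : Type*} (K : ℕ → Ω → Fin (U.m + 1)) (n : ℕ) :
    Measurable[U.history K n] (U.white K n) := by
  refine Measurable.const_add (Finset.measurable_fun_sum _ fun i hi => ?_) _
  exact (measurable_of_finite (fun k : Fin (U.m + 1) => U.a (U.m - (k : ℕ)))).comp
    (U.measurable_history K (Finset.mem_range.1 hi))

theorem measurable_black (U : Urn) {Ω : Type*} (K : ℕ → Ω → Fin (U.m + 1)) (n : ℕ) :
    Measurable[U.history K n] (U.black K n) := by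
  refine Measurable.const_add (Finset.measurable_fun_sum _ fun i hi => ?_) _
  exact (measurable_of_finite (fun k : Fin (U.m + 1) => U.b (U.m - (k : ℕ)))).comp
    (U.measurable_history K (Finset.mem_range.1 hi))

theorem measurable_composition (U : Urn) {Ω : Type*} (K : ℕ → Ω → Fin (U.m + 1)) (n : ℕ)
    (g : ℤ → ℤ → ℝ) :
    Measurable[U.history K n] fun ω => g (U.white K n ω) (U.black K n ω) := by
  have h : Measurable fun x : ℤ × ℤ => g x.1 x.2 := measurable_of_countable _
  exact h.comp ((U.measurable_white K n).prodMk (U.measurable_black K n))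

namespace IsDrawSequence

variable {U : Urn} {S : SamplingModel} {Ω : Type*} [mΩ : MeasurableSpace Ω] {μ : Measure Ω}
  {K : ℕ → Ω → Fin (U.m + 1)}

theorem history_le (hK : U.IsDrawSequence S μ K) (n : ℕ) : U.history K n ≤ mΩ :=
  iSup_le fun i => (hK.measurable i).comap_le

theorem integrable_composition [IsFiniteMeasure μ] (hK : U.IsDrawSequence S μ K) (n : ℕ)
    (g : ℤ → ℤ → ℝ) : Integrable (fun ω => g (U.white K n ω) (U.black K n ω)) μ := by
  obtain ⟨B, hB⟩ := ((U.finite_range_composition K n).image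
    fun x : ℤ × ℤ => ‖g x.1 x.2‖).bddAbove
  refine Integrable.of_bound
    ((U.measurable_composition K n g).mono (hK.history_le n) le_rfl).aestronglyMeasurable B ?_
  exact ae_of_all _ fun ω => hB ⟨_, ⟨ω, rfl⟩, rfl⟩

/-- The factor measurable with respect to the history is pulled out of the conditional expectation,
which leaves the prescribed conditional probability. -/
theorem integral_mul_indicator [IsFiniteMeasure μ] (hK : U.IsDrawSequence S μ K) (n : ℕ)
    (g : ℤ → ℤ → ℝ) (k : Fin (U.m + 1)) :
    ∫ ω, g (U.white K n ω) (U.black K n ω) * (K n ⁻¹' {k}).indicator (fun _ => (1 : ℝ)) ω ∂μ =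
      ∫ ω, g (U.white K n ω) (U.black K n ω) *
        S.drawProb U.m (U.white K n ω).toNat (U.black K n ω).toNat k ∂μ := by
  have hm := hK.history_le n
  have hs : MeasurableSet (K n ⁻¹' {k}) := hK.measurable n (measurableSet_singleton k)
  have hint : Integrable ((K n ⁻¹' {k}).indicator (fun _ => (1 : ℝ))) μ :=
    (integrable_const _).indicator hs
  have hint2 : Integrable ((fun ω => g (U.white K n ω) (U.black K n ω)) *
      (K n ⁻¹' {k}).indicator (fun _ => (1 : ℝ))) μ := by
    have := (hK.integrable_composition n g).indicator hs
    refine this.congr (ae_of_all _ fun ω => ?_)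
    by_cases h : ω ∈ K n ⁻¹' {k} <;> simp [h]
  have h1 := condExp_mul_of_stronglyMeasurable_left (μ := μ) (m := U.history K n)
    (U.measurable_composition K n g).stronglyMeasurable hint2 hint
  have h2 := integral_condExp (μ := μ) hm (f := (fun ω => g (U.white K n ω) (U.black K n ω)) *
      (K n ⁻¹' {k}).indicator (fun _ => (1 : ℝ)))
  refine h2.symm.trans (integral_congr_ae ?_)
  filter_upwards [h1, hK.condProb n k] with ω h3 h4
  rw [h3]
  simp only [Pi.mul_apply]
  rw [← h4]

/-- Integrating out the next sample. -/
theorem integral_comp_draw [IsFiniteMeasure μ] (hK : U.IsDrawSequence S μ K) (n : ℕ)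
    (g : ℤ → ℤ → ℕ → ℝ) :
    ∫ ω, g (U.white K n ω) (U.black K n ω) (K n ω) ∂μ =
      ∫ ω, ∑ k ∈ Finset.range (U.m + 1),
        S.drawProb U.m (U.white K n ω).toNat (U.black K n ω).toNat k *
          g (U.white K n ω) (U.black K n ω) k ∂μ := by
  have h1 : ∀ ω, g (U.white K n ω) (U.black K n ω) (K n ω) =
      ∑ k : Fin (U.m + 1), g (U.white K n ω) (U.black K n ω) k *
        (K n ⁻¹' {k}).indicator (fun _ => (1 : ℝ)) ω := by
    intro ω
    rw [Finset.sum_eq_single (K n ω)]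
    · simp
    · intro k _ hk
      simp [Set.indicator, Ne.symm hk]
    · simp
  simp_rw [h1, Finset.sum_range]
  rw [integral_finsetSum, integral_finsetSum]
  · refine Finset.sum_congr rfl fun k _ => ?_
    rw [hK.integral_mul_indicator n (fun w b => g w b k) k]
    simp_rw [mul_comm]
  · intro k _
    exact hK.integrable_composition n (fun w b => S.drawProb U.m w.toNat b.toNat k * g w b k)
  · intro k _
    have := (hK.integrable_composition n (fun w b => g w b k)).indicator
      (hK.measurable n (measurableSet_singleton k))
    refine this.congr (ae_of_all _ fun ω => ?_)
    by_cases h : ω ∈ K n ⁻¹' {k}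
    · simp only [Set.indicator_of_mem h, mul_one]
    · simp only [Set.indicator_of_notMem h, mul_zero]

theorem integrable_comp_draw [IsFiniteMeasure μ] (hK : U.IsDrawSequence S μ K) (n : ℕ)
    (g : ℤ → ℤ → ℕ → ℝ) :
    Integrable (fun ω => g (U.white K n ω) (U.black K n ω) (K n ω)) μ := by
  obtain ⟨B, hB⟩ := (((U.finite_range_composition K n).prod
    (Set.finite_univ (α := Fin (U.m + 1)))).image
    fun x : (ℤ × ℤ) × Fin (U.m + 1) => ‖g x.1.1 x.1.2 x.2‖).bddAbove
  refine Integrable.of_bound (Measurable.aestronglyMeasurable ?_) B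
    (ae_of_all _ fun ω => hB ⟨((_, _), K n ω), ⟨⟨ω, rfl⟩, Set.mem_univ _⟩, rfl⟩)
  have h : Measurable fun x : (ℤ × ℤ) × Fin (U.m + 1) => g x.1.1 x.1.2 x.2 :=
    measurable_of_countable _
  exact h.comp ((((U.measurable_white K n).mono (hK.history_le n) le_rfl).prodMk
    ((U.measurable_black K n).mono (hK.history_le n) le_rfl)).prodMk (hK.measurable n))

/-- Tenability speaks of reachable configurations; this carries it over to the random process. -/
theorem ae_reachable [IsFiniteMeasure μ] (hK : U.IsDrawSequence S μ K) (n : ℕ) :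
    ∀ᵐ ω ∂μ, U.Reachable S n (U.white K n ω) (U.black K n ω) := by
  induction n with
  | zero => exact ae_of_all _ fun ω => by simpa [white, black] using Reachable.init
  | succ n ih =>
    classical
    -- The indicator of a sample of probability zero: its product with the drawing weight vanishes,
    -- so it has integral zero and is almost surely zero.
    let g : ℤ → ℤ → ℕ → ℝ := fun w b k => if S.drawProb U.m w.toNat b.toNat k = 0 then 1 else 0
    have h0 := hK.integral_comp_draw n g
    have h1 : ∀ w b k, S.drawProb U.m w.toNat b.toNat k * g w b k = 0 := by
      intro w b k
      simp only [g]
      split_ifs with h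
      · simp [h]
      · simp
    simp only [h1, Finset.sum_const_zero, integral_zero] at h0
    rw [integral_eq_zero_iff_of_nonneg (fun ω => by simp only [g]; split_ifs <;> simp)
      (hK.integrable_comp_draw n g)] at h0
    filter_upwards [ih, h0] with ω h2 h3
    rw [white_succ, black_succ]
    refine .step n _ _ _ h2 (Nat.lt_succ_iff.1 (K n ω).2) ?_
    refine lt_of_le_of_ne (S.drawProb_nonneg _ _ _ _) fun h4 => ?_
    simp only [g, ← h4] at h3
    simp at h3

end IsDrawSequence

end Urn

/-! ### The moment recursion and its solution. -/

theorem Finset.prod_Icc_one_eq_prod_range {M : Type*} [CommMonoid M] (g : ℕ → M) (n : ℕ) :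
    ∏ j ∈ Finset.Icc 1 n, g j = ∏ j ∈ Finset.range n, g (j + 1) := by
  induction n with
  | zero => simp
  | succ n ih => rw [Finset.prod_Icc_succ_top (by omega), ih, Finset.prod_range_succ]

namespace Urn

/-- The shift per draw, `a_m / (1 - Λ)`. -/
noncomputable def drift (U : Urn) : ℝ := (U.am : ℝ) / (1 - U.Λ)

/-- Allows Λ to be factored out of the centred increment, whence the powers Λ^j in the coefficients.
At Λ = 1 division by zero is harmless, because a_m = 0. -/
theorem drift_eq {U : Urn} {S : SamplingModel} (hT : U.Tenable S) (hA : U.IsAffine S) :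
    (U.am : ℝ) - U.drift = U.Λ * ((U.am : ℝ) / (U.Λ - 1)) := by
  by_cases h : U.Λ = 1
  · simp [drift, am_eq_zero_of_Λ_eq_one hT hA h]
  · have h1 : 1 - U.Λ ≠ 0 := fun h' => h (by linarith)
    have h2 : U.Λ - 1 ≠ 0 := fun h' => h (by linarith)
    simp only [drift]
    field_simp
    ring

theorem shifted_eq (U : Urn) {Ω : Type*} (K : ℕ → Ω → Fin (U.m + 1)) (n : ℕ) (ω : Ω) :
    U.shifted K n ω = U.white K n ω - U.drift * n := rfl

/-- The coefficients `f` arise by collecting powers of `x` in the expansion of a one-step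
moment. -/
theorem sum_f_mul_pow (U : Urn) (S : SamplingModel) (n s : ℕ) (x : ℝ) :
    ∑ r ∈ Finset.range (s + 1), U.f S (n + 1) s r * x ^ r =
      ∑ j ∈ Finset.range (s + 1), (s.choose j : ℝ) * U.Λ ^ j * x ^ (s - j) *
        ∑ i ∈ Finset.range (j + 1), (j.choose i : ℝ) *
          (((U.σ : ℝ) ^ i * (U.am : ℝ) ^ (j - i)) / ((U.m : ℝ) ^ i * (U.Λ - 1) ^ (j - i))) *
          ∑ l ∈ Finset.range (i + 1), U.p S (n + 1) i l * (x + U.drift * n) ^ l := by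
  have hL : ∀ r ∈ Finset.range (s + 1), U.f S (n + 1) s r * x ^ r =
      ∑ j ∈ Finset.Icc (s - r) s, (s.choose j : ℝ) * U.Λ ^ j * x ^ (s - j) *
      ∑ l ∈ Finset.Icc (j - (s - r)) j, ∑ i ∈ Finset.Icc l j, (j.choose i : ℝ) *
          (((U.σ : ℝ) ^ i * (U.am : ℝ) ^ (j - i)) / ((U.m : ℝ) ^ i * (U.Λ - 1) ^ (j - i))) *
          (U.p S (n + 1) i l * ((l.choose (j - (s - r)) : ℝ) *
            (U.drift * n) ^ (l - (j - (s - r))) * x ^ (j - (s - r)))) := by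
    intro r hr
    have hr := Finset.mem_range.1 hr
    simp only [f, Finset.sum_mul, Finset.mul_sum]
    refine Finset.sum_congr rfl fun j hj => Finset.sum_congr rfl fun l hl =>
      Finset.sum_congr rfl fun i _ => ?_
    have hj := Finset.mem_Icc.1 hj
    have hl := Finset.mem_Icc.1 hl
    have h1 : ((n + 1 : ℕ) : ℝ) - 1 = n := by push_cast; ring
    have h2 : x ^ r = x ^ (s - j) * x ^ (j - (s - r)) := by
      rw [← pow_add]
      congr 1
      omega
    rw [h1, h2, show l + (s - r) - j = l - (j - (s - r)) by omega, drift,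
      mul_div_right_comm (U.am : ℝ)]
    ring
  rw [Finset.sum_congr rfl hL]
  have hbin : ∀ l, (x + U.drift * n) ^ l = ∑ t ∈ Finset.range (l + 1),
      (l.choose t : ℝ) * (U.drift * n) ^ (l - t) * x ^ t := by
    intro l
    rw [add_pow]
    exact Finset.sum_congr rfl fun t _ => by ring
  have hin : ∀ j, ∑ i ∈ Finset.range (j + 1), (j.choose i : ℝ) *
          (((U.σ : ℝ) ^ i * (U.am : ℝ) ^ (j - i)) / ((U.m : ℝ) ^ i * (U.Λ - 1) ^ (j - i))) *
          ∑ l ∈ Finset.range (i + 1), U.p S (n + 1) i l * (x + U.drift * n) ^ l =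
      ∑ t ∈ Finset.range (j + 1), ∑ l ∈ Finset.Icc t j, ∑ i ∈ Finset.Icc l j, (j.choose i : ℝ) *
          (((U.σ : ℝ) ^ i * (U.am : ℝ) ^ (j - i)) / ((U.m : ℝ) ^ i * (U.Λ - 1) ^ (j - i))) *
          (U.p S (n + 1) i l * ((l.choose t : ℝ) * (U.drift * n) ^ (l - t) * x ^ t)) := by
    intro j
    simp only [hbin, Finset.mul_sum]
    refine (Finset.sum_comm' (s' := fun l => Finset.Icc l j) (t' := Finset.range (j + 1))
      ?_).trans ?_
    · intro i l
      simp only [Finset.mem_range, Finset.mem_Icc]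
      omega
    symm
    refine (Finset.sum_comm' (s' := fun l => Finset.range (l + 1)) (t' := Finset.range (j + 1))
      ?_).trans ?_
    · intro t l
      simp only [Finset.mem_range, Finset.mem_Icc]
      omega
    · exact Finset.sum_congr rfl fun l _ => Finset.sum_comm
  simp_rw [hin]
  rw [Finset.sum_comm' (s' := fun j => Finset.Icc (s - j) s) (t' := Finset.range (s + 1))]
  · refine Finset.sum_congr rfl fun j hj => ?_
    have hj := Finset.mem_range.1 hj
    rw [← Finset.mul_sum]
    congr 1
    -- A total power r of x is made of s - j from the outer binomial and t = j - (s - r) from the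
    -- expansion of the shifted power.
    refine Finset.sum_bij (fun r _ => j - (s - r)) ?_ ?_ ?_ ?_
    · intro r hr
      simp only [Finset.mem_range, Finset.mem_Icc] at hr ⊢
      omega
    · intro r hr r' hr' h
      simp only [Finset.mem_Icc] at hr hr'
      omega
    · intro t ht
      have := Finset.mem_range.1 ht
      exact ⟨s - j + t, Finset.mem_Icc.2 (by omega), by omega⟩
    · intro r _
      rfl
  · intro r j
    simp only [Finset.mem_range, Finset.mem_Icc]
    omega

/-- The conditional moments of the shifted number of white balls after the next draw. -/
theorem sum_drawProb_mul_shifted_pow {U : Urn} {S : SamplingModel} (hT : U.Tenable S)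
    (hA : U.IsAffine S) (n s w b : ℕ) (hwb : w + b = U.T n) :
    ∑ k ∈ Finset.range (U.m + 1), S.drawProb U.m w b k *
        ((w : ℝ) + (U.a (U.m - k) : ℝ) - U.drift * ((n + 1 : ℕ) : ℝ)) ^ s =
      ∑ r ∈ Finset.range (s + 1), U.f S (n + 1) s r * ((w : ℝ) - U.drift * n) ^ r := by
  rw [sum_f_mul_pow]
  simp only [sub_add_cancel, ← U.sum_drawProb_mul_pow S n w b _ hwb]
  set x : ℝ := (w : ℝ) - U.drift * n with hx
  have hm : (U.m : ℝ) ≠ 0 := by exact_mod_cast (Nat.pos_iff_ne_zero.1 U.one_le_m)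
  have hσ : (U.σ : ℝ) ≠ 0 := by exact_mod_cast (Nat.pos_iff_ne_zero.1 U.one_le_σ)
  have h1 : ∀ k ∈ Finset.range (U.m + 1), S.drawProb U.m w b k *
        ((w : ℝ) + (U.a (U.m - k) : ℝ) - U.drift * ((n + 1 : ℕ) : ℝ)) ^ s =
      ∑ j ∈ Finset.range (s + 1), ∑ i ∈ Finset.range (j + 1), (s.choose j : ℝ) * U.Λ ^ j *
        x ^ (s - j) * ((j.choose i : ℝ) *
          (((U.σ : ℝ) ^ i * (U.am : ℝ) ^ (j - i)) / ((U.m : ℝ) ^ i * (U.Λ - 1) ^ (j - i)))) *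
        (S.drawProb U.m w b k * (k : ℝ) ^ i) := by
    intro k hk
    have h2 : (U.a (U.m - k) : ℝ) = U.am + k * U.C := by
      rw [hA.a_eq (Nat.lt_succ_iff.1 (Finset.mem_range.1 hk)), C_eq]
      push_cast
      ring
    have h3 : (w : ℝ) + (U.a (U.m - k) : ℝ) - U.drift * ((n + 1 : ℕ) : ℝ) =
        U.Λ * ((U.σ : ℝ) / U.m * k + (U.am : ℝ) / (U.Λ - 1)) + x := by
      rw [h2, mul_add, ← drift_eq hT hA, Λ_eq, hx]
      push_cast
      field_simp
      ring
    rw [h3, add_pow, Finset.mul_sum]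
    refine Finset.sum_congr rfl fun j _ => ?_
    rw [mul_pow, add_pow, Finset.mul_sum, Finset.sum_mul, Finset.sum_mul, Finset.mul_sum]
    refine Finset.sum_congr rfl fun i _ => ?_
    rw [mul_pow, div_pow, div_pow, mul_div_mul_comm]
    ring
  rw [Finset.sum_congr rfl h1, Finset.sum_comm]
  refine Finset.sum_congr rfl fun j _ => ?_
  rw [Finset.sum_comm, Finset.mul_sum]
  refine Finset.sum_congr rfl fun i _ => ?_
  rw [← Finset.mul_sum]
  ring

/-- The moments of the shifted number of white balls. -/
noncomputable def moment (U : Urn) {Ω : Type*} [MeasurableSpace Ω] (μ : Measure Ω)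
    (K : ℕ → Ω → Fin (U.m + 1)) (s n : ℕ) : ℝ := ∫ ω, (U.shifted K n ω) ^ s ∂μ

namespace IsDrawSequence

variable {U : Urn} {S : SamplingModel} {Ω : Type*} [mΩ : MeasurableSpace Ω] {μ : Measure Ω}
  {K : ℕ → Ω → Fin (U.m + 1)}

/-- The one-step identity needs natural numbers of balls, so it is integrated over the almost sure
event that the configuration is reachable. -/
theorem moment_succ [IsProbabilityMeasure μ] (hK : U.IsDrawSequence S μ K) (hT : U.Tenable S)
    (hA : U.IsAffine S) (s n : ℕ) :
    U.moment μ K s (n + 1) =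
      ∑ r ∈ Finset.range (s + 1), U.f S (n + 1) s r * U.moment μ K r n := by
  have h1 : U.moment μ K s (n + 1) = ∫ ω, ((U.white K n ω : ℝ) + (U.a (U.m - (K n ω : ℕ)) : ℝ) -
      U.drift * ((n + 1 : ℕ) : ℝ)) ^ s ∂μ := by
    simp only [moment, shifted_eq, white_succ, Int.cast_add]
  rw [h1, hK.integral_comp_draw n (fun w _ k => ((w : ℝ) + (U.a (U.m - k) : ℝ) -
      U.drift * ((n + 1 : ℕ) : ℝ)) ^ s)]
  have h2 : ∀ r, U.f S (n + 1) s r * U.moment μ K r n =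
      ∫ ω, U.f S (n + 1) s r * (U.shifted K n ω) ^ r ∂μ := fun r => by
    rw [integral_const_mul, moment]
  simp_rw [h2]
  rw [← integral_finsetSum]
  · refine integral_congr_ae ?_
    filter_upwards [hK.ae_reachable n] with ω hω
    obtain ⟨w, b, hw, hb, hwb⟩ := hω.exists_nat hT
    simp only [shifted_eq, hw, hb, Int.toNat_natCast, Int.cast_natCast]
    exact sum_drawProb_mul_shifted_pow hT hA n s w b hwb
  · intro r _
    exact (hK.integrable_composition n
      (fun w _ => ((w : ℝ) - U.drift * n) ^ r)).const_mul _

theorem moment_zero_right (U : Urn) [IsProbabilityMeasure μ] (K : ℕ → Ω → Fin (U.m + 1)) (s : ℕ) :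
    U.moment μ K s 0 = (U.W0 : ℝ) ^ s := by
  simp [moment, shifted_eq, white]

theorem moment_zero_left (U : Urn) [IsProbabilityMeasure μ] (K : ℕ → Ω → Fin (U.m + 1)) (n : ℕ) :
    U.moment μ K 0 n = 1 := by
  simp [moment]

/-- Variation of constants: after division by the product of the diagonal coefficients the recursion
telescopes. -/
theorem moment_eq_prod_mul [IsProbabilityMeasure μ] (hK : U.IsDrawSequence S μ K)
    (hT : U.Tenable S) (hA : U.IsAffine S) (s : ℕ) (hf : ∀ j, U.f S (j + 1) s s ≠ 0) (n : ℕ) :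
    U.moment μ K s n = (∏ j ∈ Finset.range n, U.f S (j + 1) s s) *
      ((U.W0 : ℝ) ^ s + ∑ l ∈ Finset.range n, U.term S μ K s (l + 1)) := by
  induction n with
  | zero => simp [moment_zero_right]
  | succ n ih =>
    have h0 : ∏ j ∈ Finset.range (n + 1), U.f S (j + 1) s s ≠ 0 :=
      Finset.prod_ne_zero_iff.2 fun j _ => hf j
    have h1 : (∏ j ∈ Finset.range (n + 1), U.f S (j + 1) s s) * U.term S μ K s (n + 1) =
        ∑ r ∈ Finset.range s, U.f S (n + 1) s r * U.moment μ K r n := by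
      rw [term, Finset.prod_Icc_one_eq_prod_range, mul_div_cancel₀ _ h0]
      rfl
    rw [Finset.sum_range_succ, ← add_assoc, mul_add, h1, Finset.prod_range_succ,
      hK.moment_succ hT hA, Finset.sum_range_succ, ih]
    ring

end IsDrawSequence

end Urn

/-! ### Products of rational functions and the gamma function. -/

theorem Complex.multiset_prod_GammaSeq (A : Multiset ℂ) {n : ℕ} (hn : n ≠ 0) :
    (A.map fun z => Complex.GammaSeq z n).prod =
      (n : ℂ) ^ A.sum * (n.factorial : ℂ) ^ A.card /
        ∏ j ∈ Finset.range (n + 1), (A.map fun z => z + (j : ℂ)).prod := by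
  have hn' : (n : ℂ) ≠ 0 := by exact_mod_cast hn
  induction A using Multiset.induction_on with
  | empty => simp
  | cons a A ih =>
    simp only [Multiset.map_cons, Multiset.prod_cons, ih, Multiset.sum_cons, Multiset.card_cons,
      Finset.prod_mul_distrib]
    rw [Complex.GammaSeq, Complex.cpow_add _ _ hn', pow_succ, div_mul_div_comm]
    ring

/-- Quotient of two Euler limits for Γ. Equal cardinalities cancel the factorials, and only the
power of n given by the difference of the sums is left. -/
theorem Complex.tendsto_prod_multiset_ratio (A B : Multiset ℂ) (hAB : A.card = B.card)
    (hA : ∀ z ∈ A, ∀ m : ℕ, z ≠ -m) (hB : ∀ z ∈ B, ∀ m : ℕ, z ≠ -m) :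
    Tendsto (fun n : ℕ => (∏ j ∈ Finset.range (n + 1), ((B.map fun z => z + (j : ℂ)).prod /
      (A.map fun z => z + (j : ℂ)).prod)) * (n : ℂ) ^ (A.sum - B.sum)) atTop
      (𝓝 ((A.map Complex.Gamma).prod / (B.map Complex.Gamma).prod)) := by
  have hB0 : (B.map Complex.Gamma).prod ≠ 0 := by
    refine Multiset.prod_ne_zero fun h => ?_
    obtain ⟨z, hz, h⟩ := Multiset.mem_map.1 h
    exact Complex.Gamma_ne_zero (hB z hz) h
  have h := (tendsto_multiset_prod A fun z _ => Complex.GammaSeq_tendsto_Gamma z).div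
    (tendsto_multiset_prod B fun z _ => Complex.GammaSeq_tendsto_Gamma z) hB0
  refine h.congr' ?_
  filter_upwards [eventually_ne_atTop 0] with n hn
  have hn' : (n : ℂ) ≠ 0 := by exact_mod_cast hn
  have hne : ∀ D : Multiset ℂ, (∀ z ∈ D, ∀ m : ℕ, z ≠ -m) →
      ∏ j ∈ Finset.range (n + 1), (D.map fun z => z + (j : ℂ)).prod ≠ 0 := by
    intro D hD
    refine Finset.prod_ne_zero_iff.2 fun j _ => Multiset.prod_ne_zero fun h => ?_
    obtain ⟨z, hz, h⟩ := Multiset.mem_map.1 h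
    exact hD z hz j (eq_neg_of_add_eq_zero_left h)
  have hf : (n.factorial : ℂ) ≠ 0 := by exact_mod_cast n.factorial_ne_zero
  have h1 : (n : ℂ) ^ B.sum ≠ 0 := by simp [Complex.cpow_eq_zero_iff, hn']
  have hA1 := hne A hA
  have hB1 := hne B hB
  simp only [Pi.div_apply]
  rw [Complex.multiset_prod_GammaSeq A hn, Complex.multiset_prod_GammaSeq B hn, hAB,
    Finset.prod_div_distrib, Complex.cpow_sub _ _ hn']
  field_simp

/-- The polynomial `∑_{l ≤ d} c_l (X + ν_l) ⋯ (X + ν_{d-1})`. -/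
noncomputable def Polynomial.newtonSum (ν c : ℕ → ℝ) (d : ℕ) : ℝ[X] :=
  ∑ l ∈ Finset.range (d + 1), Polynomial.C (c l) *
    ∏ i ∈ Finset.Ico l d, (Polynomial.X + Polynomial.C (ν i))

namespace Polynomial

theorem monic_prod_Ico (ν : ℕ → ℝ) (l d : ℕ) :
    (∏ i ∈ Finset.Ico l d, (X + C (ν i))).Monic :=
  monic_prod_of_monic _ _ fun _ _ => monic_X_add_C _

theorem natDegree_prod_Ico (ν : ℕ → ℝ) (l d : ℕ) :
    (∏ i ∈ Finset.Ico l d, (X + C (ν i))).natDegree = d - l := by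
  rw [natDegree_prod_of_monic _ _ fun i _ => monic_X_add_C _]
  simp

theorem newtonSum_eq (ν c : ℕ → ℝ) (d : ℕ) (hc : c 0 = 1) :
    newtonSum ν c d = ∏ i ∈ Finset.Ico 0 d, (X + C (ν i)) +
      ∑ l ∈ Finset.range d, C (c (l + 1)) * ∏ i ∈ Finset.Ico (l + 1) d, (X + C (ν i)) := by
  rw [newtonSum, Finset.sum_range_succ', hc, C_1, one_mul, add_comm]

theorem degree_newtonSum_tail_lt (ν c : ℕ → ℝ) (d : ℕ) :
    (∑ l ∈ Finset.range d, C (c (l + 1)) *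
      ∏ i ∈ Finset.Ico (l + 1) d, (X + C (ν i))).degree < (d : WithBot ℕ) := by
  refine (degree_sum_le _ _).trans_lt ((Finset.sup_lt_iff (WithBot.bot_lt_coe d)).2 ?_)
  intro l hl
  have hl := Finset.mem_range.1 hl
  rw [C_mul']
  refine (degree_smul_le _ _).trans_lt ?_
  rw [degree_eq_natDegree (monic_prod_Ico ν _ _).ne_zero, natDegree_prod_Ico]
  exact Nat.cast_lt.2 (by omega)

theorem monic_newtonSum (ν c : ℕ → ℝ) (d : ℕ) (hc : c 0 = 1) : (newtonSum ν c d).Monic := by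
  rw [newtonSum_eq ν c d hc]
  refine (monic_prod_Ico ν 0 d).add_of_left ?_
  rw [degree_eq_natDegree (monic_prod_Ico ν _ _).ne_zero, natDegree_prod_Ico, Nat.sub_zero]
  exact degree_newtonSum_tail_lt ν c d

theorem natDegree_newtonSum (ν c : ℕ → ℝ) (d : ℕ) (hc : c 0 = 1) :
    (newtonSum ν c d).natDegree = d := by
  rw [newtonSum_eq ν c d hc, natDegree_add_eq_left_of_degree_lt, natDegree_prod_Ico, Nat.sub_zero]
  rw [degree_eq_natDegree (monic_prod_Ico ν _ _).ne_zero, natDegree_prod_Ico, Nat.sub_zero]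
  exact degree_newtonSum_tail_lt ν c d

/-- Only the summands l = 0 and l = 1 reach degree d - 1. This coefficient gives the sum of the
roots, hence the growth exponent of the products. -/
theorem nextCoeff_newtonSum (ν c : ℕ → ℝ) (d : ℕ) (hc : c 0 = 1) (hd : d ≠ 0) :
    (newtonSum ν c d).nextCoeff = ∑ i ∈ Finset.range d, ν i + c 1 := by
  obtain ⟨e, rfl⟩ := Nat.exists_eq_succ_of_ne_zero hd
  rw [nextCoeff_of_natDegree_pos (by rw [natDegree_newtonSum ν c _ hc]; omega),
    natDegree_newtonSum ν c _ hc, newtonSum_eq ν c _ hc, coeff_add]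
  congr 1
  · have h := Monic.nextCoeff_prod (Finset.Ico 0 (e + 1)) (fun i => X + C (ν i))
      fun i _ => monic_X_add_C _
    rw [nextCoeff_of_natDegree_pos (by rw [natDegree_prod_Ico]; omega), natDegree_prod_Ico] at h
    simp only [nextCoeff_X_add_C] at h
    rw [Finset.range_eq_Ico]
    exact h
  · rw [finsetSum_coeff, Finset.sum_range_succ', Finset.sum_eq_zero, zero_add]
    · rw [coeff_C_mul]
      have := (monic_prod_Ico ν 1 (e + 1)).coeff_natDegree
      rw [natDegree_prod_Ico] at this
      simp only [Nat.succ_eq_add_one, zero_add] at this ⊢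
      rw [this, mul_one]
    · intro l hl
      rw [coeff_C_mul, coeff_eq_zero_of_natDegree_lt, mul_zero]
      rw [natDegree_prod_Ico]
      have := Finset.mem_range.1 hl
      omega

theorem eval_newtonSum (ν c : ℕ → ℝ) (d : ℕ) (x : ℝ) :
    (newtonSum ν c d).eval x =
      ∑ l ∈ Finset.range (d + 1), c l * ∏ i ∈ Finset.Ico l d, (x + ν i) := by
  simp [newtonSum, eval_finsetSum, eval_prod]

/-- All summands are nonnegative and the leading one is positive. This yields both the positivity of
f_{j,s,s} and the absence of nonnegative integer roots. -/
theorem eval_newtonSum_pos (ν c : ℕ → ℝ) (d : ℕ) (hc : c 0 = 1) (hc' : ∀ l, 0 ≤ c l)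
    (hν : ∀ i < d, 0 < ν i) {x : ℝ} (hx : 0 ≤ x) : 0 < (newtonSum ν c d).eval x := by
  have hpos : ∀ l, 0 < ∏ i ∈ Finset.Ico l d, (x + ν i) := fun l =>
    Finset.prod_pos fun i hi => add_pos_of_nonneg_of_pos hx (hν i (Finset.mem_Ico.1 hi).2)
  rw [eval_newtonSum, Finset.sum_range_succ', hc, one_mul]
  exact add_pos_of_nonneg_of_pos
    (Finset.sum_nonneg fun l _ => mul_nonneg (hc' _) (hpos _).le) (hpos 0)

theorem ne_natCast_of_mem_aroots_newtonSum (ν c : ℕ → ℝ) (d : ℕ) (hc : c 0 = 1)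
    (hc' : ∀ l, 0 ≤ c l) (hν : ∀ i < d, 0 < ν i) :
    ∀ z ∈ (newtonSum ν c d).aroots ℂ, ∀ n : ℕ, -z ≠ -(n : ℂ) := by
  intro z hz n h
  have h1 : z = ((n : ℝ) : ℂ) := by
    rw [neg_inj.1 h]
    simp
  have h2 := (mem_aroots.1 hz).2
  rw [h1] at h2
  have h3 : aeval ((algebraMap ℝ ℂ) (n : ℝ)) (newtonSum ν c d) = 0 := h2
  rw [aeval_algebraMap_apply_eq_algebraMap_eval] at h3
  have h4 := eval_newtonSum_pos ν c d hc hc' hν (Nat.cast_nonneg n)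
  have h5 : (((newtonSum ν c d).eval (n : ℝ) : ℝ) : ℂ) = 0 := h3
  rw [Complex.ofReal_eq_zero] at h5
  exact h4.ne' h5

/-- Products of values of `newtonSum` grow like a power, with a constant expressed through the
gamma function. -/
theorem tendsto_prod_newtonSum (ν c : ℕ → ℝ) (d : ℕ) (hd : d ≠ 0) (hc : c 0 = 1)
    (hc' : ∀ l, 0 ≤ c l) (hν : ∀ i < d, 0 < ν i) :
    ∃ L : ℝ, L ≠ 0 ∧ (L : ℂ) = (∏ i ∈ Finset.range d, Complex.Gamma (ν i)) /
        Urn.gammaNegRoots (newtonSum ν c d) ∧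
      Tendsto (fun n : ℕ => (∏ j ∈ Finset.range n, ((newtonSum ν c d).eval (j : ℝ) /
        ∏ i ∈ Finset.range d, ((j : ℝ) + ν i))) / (n : ℝ) ^ c 1) atTop (𝓝 L) := by
  set q := newtonSum ν c d with hq
  have hmon : q.Monic := monic_newtonSum ν c d hc
  have hmon' : (q.map (algebraMap ℝ ℂ)).Monic := hmon.map _
  have hsplit : (q.map (algebraMap ℝ ℂ)).Splits := IsAlgClosed.splits _
  set A : Multiset ℂ := (Finset.range d).val.map fun i => (ν i : ℂ) with hA
  set B : Multiset ℂ := (q.aroots ℂ).map fun z => -z with hB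
  have hcardA : A.card = d := by simp [hA]
  have hcardB : B.card = d := by
    rw [hB, Multiset.card_map, aroots, ← hsplit.natDegree_eq_card_roots, natDegree_map,
      natDegree_newtonSum ν c d hc]
  -- By Vieta the negated roots sum to ∑ ν_i + c_1, so the nodes cancel.
  have hsum : A.sum - B.sum = -(c 1 : ℂ) := by
    have h1 := hsplit.nextCoeff_eq_neg_sum_roots_of_monic hmon'
    rw [nextCoeff_map (algebraMap ℝ ℂ).injective, nextCoeff_newtonSum ν c d hc hd] at h1
    have h2 : B.sum = -(q.aroots ℂ).sum := by
      rw [hB, Multiset.sum_map_neg']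
    have h3 : A.sum = ∑ i ∈ Finset.range d, (ν i : ℂ) := rfl
    rw [h2, aroots, ← h1, h3]
    simp
  have hAne : ∀ z ∈ A, ∀ m : ℕ, z ≠ -m := by
    intro z hz m h
    obtain ⟨i, hi, rfl⟩ := Multiset.mem_map.1 hz
    have h1 := hν i (Finset.mem_range.1 hi)
    have h2 : ν i = -(m : ℝ) := by exact_mod_cast h
    have : (0 : ℝ) ≤ m := Nat.cast_nonneg m
    linarith
  have hBne : ∀ z ∈ B, ∀ m : ℕ, z ≠ -m := by
    intro z hz m
    obtain ⟨y, hy, rfl⟩ := Multiset.mem_map.1 hz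
    exact ne_natCast_of_mem_aroots_newtonSum ν c d hc hc' hν y hy m
  have key := Complex.tendsto_prod_multiset_ratio A B (hcardA.trans hcardB.symm) hAne hBne
  set F : ℕ → ℝ := fun j => q.eval (j : ℝ) / ∏ i ∈ Finset.range d, ((j : ℝ) + ν i) with hF
  have hFc : ∀ j : ℕ, (B.map fun z => z + (j : ℂ)).prod / (A.map fun z => z + (j : ℂ)).prod =
      (F j : ℂ) := by
    intro j
    have h1 : (B.map fun z => z + (j : ℂ)).prod = ((q.eval (j : ℝ) : ℝ) : ℂ) := by
      have h2 := hsplit.eval_eq_prod_roots_of_monic hmon' ((j : ℝ) : ℂ)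
      have h3 : (q.map (algebraMap ℝ ℂ)).eval ((j : ℝ) : ℂ) = ((q.eval (j : ℝ) : ℝ) : ℂ) := by
        exact eval_map_algebraMap q (_ : ℂ) ▸ aeval_algebraMap_apply_eq_algebraMap_eval (j : ℝ) q
      rw [← h3, h2, hB, Multiset.map_map]
      congr 1
      refine Multiset.map_congr rfl fun z _ => ?_
      simp only [Function.comp_apply, Complex.ofReal_natCast]
      ring
    have h4 : (A.map fun z => z + (j : ℂ)).prod =
        ∏ i ∈ Finset.range d, ((ν i : ℂ) + j) := by
      rw [hA, Multiset.map_map]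
      rfl
    rw [h1, h4, hF]
    push_cast
    congr 1
    exact Finset.prod_congr rfl fun i _ => add_comm _ _
  have hv : Tendsto (fun n : ℕ => (((∏ j ∈ Finset.range (n + 1), F j) / (n : ℝ) ^ c 1 : ℝ) : ℂ))
      atTop (𝓝 ((A.map Complex.Gamma).prod / (B.map Complex.Gamma).prod)) := by
    refine key.congr fun n => ?_
    simp only [hFc, hsum]
    rw [Complex.cpow_neg, Complex.ofReal_div, Complex.ofReal_prod,
      Complex.ofReal_cpow (Nat.cast_nonneg n), div_eq_mul_inv, Complex.ofReal_natCast]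
  have hprodne : ∀ D : Multiset ℂ, (∀ z ∈ D, ∀ m : ℕ, z ≠ -m) →
      (D.map Complex.Gamma).prod ≠ 0 := by
    intro D hD
    refine Multiset.prod_ne_zero fun h => ?_
    obtain ⟨z, hz, h⟩ := Multiset.mem_map.1 h
    exact Complex.Gamma_ne_zero (hD z hz) h
  set Z := (A.map Complex.Gamma).prod / (B.map Complex.Gamma).prod with hZ
  have hre : Tendsto (fun n : ℕ => (∏ j ∈ Finset.range (n + 1), F j) / (n : ℝ) ^ c 1) atTop
      (𝓝 Z.re) :=
    ((Complex.continuous_re.tendsto Z).comp hv).congr fun n => Complex.ofReal_re _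
  -- A limit of real numbers is real, although the individual roots need not be.
  have hZre : (Z.re : ℂ) = Z :=
    tendsto_nhds_unique ((Complex.continuous_ofReal.tendsto _).comp hre) hv
  refine ⟨Z.re, ?_, ?_, ?_⟩
  · intro h
    rw [h, Complex.ofReal_zero] at hZre
    exact div_ne_zero (hprodne A hAne) (hprodne B hBne) hZre.symm
  · rw [hZre, hZ, hA, hB, Multiset.map_map, Multiset.map_map]
    rfl
  -- Euler's formula has n + 1 factors against n^{c_1}; re-indexing costs the factor
  -- (n/(n+1))^{c_1}, which tends to 1.
  · refine (tendsto_add_atTop_iff_nat 1).1 ?_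
    have h1 : Tendsto (fun n : ℕ => ((n : ℝ) / ((n : ℝ) + 1)) ^ c 1) atTop (𝓝 1) := by
      have := tendsto_natCast_div_add_atTop (𝕜 := ℝ) (1 : ℝ)
      simpa using this.rpow_const (p := c 1) (Or.inl one_ne_zero)
    have h2 := hre.mul h1
    rw [mul_one] at h2
    refine h2.congr' ?_
    filter_upwards [eventually_ne_atTop 0] with n hn
    have h3 : (0 : ℝ) < n := by exact_mod_cast Nat.pos_of_ne_zero hn
    have h4 := (Real.rpow_pos_of_pos h3 (c 1)).ne'
    rw [Real.div_rpow h3.le (by positivity), Nat.cast_add, Nat.cast_one]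
    field_simp

end Polynomial

theorem Polynomial.eval_newtonSum_div_prod (ν c : ℕ → ℝ) (d : ℕ) (x : ℝ)
    (hx : ∀ i < d, x + ν i ≠ 0) :
    (newtonSum ν c d).eval x / ∏ i ∈ Finset.range d, (x + ν i) =
      ∑ l ∈ Finset.range (d + 1), c l / ∏ i ∈ Finset.range l, (x + ν i) := by
  rw [eval_newtonSum, Finset.sum_div]
  refine Finset.sum_congr rfl fun l hl => ?_
  have hl : l ≤ d := Nat.lt_succ_iff.1 (Finset.mem_range.1 hl)
  have h1 : ∏ i ∈ Finset.Ico l d, (x + ν i) ≠ 0 :=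
    Finset.prod_ne_zero_iff.2 fun i hi => hx i (Finset.mem_Ico.1 hi).2
  rw [← Finset.prod_range_mul_prod_Ico _ hl, mul_div_mul_right _ _ h1]

/-! ### The diagonal coefficients as quotients of polynomials. -/

namespace Urn

/-- The negated roots of the common denominator of the coefficients `f_{n,s,s}`. -/
noncomputable def node (U : Urn) (S : SamplingModel) (i : ℕ) : ℝ :=
  match S with
  | SamplingModel.withoutReplacement => ((U.T0 : ℝ) - i) / U.σ
  | SamplingModel.withReplacement => (U.T0 : ℝ) / U.σ

/-- The degree of the polynomials `P_s` and `Q_s`. -/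
def polyDegree (U : Urn) (S : SamplingModel) (s : ℕ) : ℕ :=
  match S with
  | SamplingModel.withoutReplacement => U.sStar s
  | SamplingModel.withReplacement => s

/-- The coefficients of `P_s` and `Q_s` in the Newton basis. -/
noncomputable def polyCoeff (U : Urn) (s l : ℕ) : ℝ :=
  (s.choose l : ℝ) * U.m.descFactorial l * (U.C / U.σ) ^ l

theorem σ_pos (U : Urn) : (0 : ℝ) < U.σ := by exact_mod_cast U.one_le_σ

theorem polyCoeff_zero (U : Urn) (s : ℕ) : U.polyCoeff s 0 = 1 := by simp [polyCoeff]

theorem polyCoeff_one (U : Urn) (s : ℕ) : U.polyCoeff s 1 = s * U.Λ := by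
  simp only [polyCoeff, Nat.choose_one_right, Nat.descFactorial_one, pow_one, Λ_eq]
  ring

theorem polyCoeff_nonneg (U : Urn) (hC : 0 < U.C) (s l : ℕ) : 0 ≤ U.polyCoeff s l := by
  have := U.σ_pos
  unfold polyCoeff
  positivity

theorem polyDegree_ne_zero (U : Urn) (S : SamplingModel) {s : ℕ} (hs : 1 ≤ s) :
    U.polyDegree S s ≠ 0 := by
  have := U.one_le_m
  cases S <;> simp only [polyDegree, sStar] <;> omega

theorem node_pos (U : Urn) (S : SamplingModel) (s : ℕ) :
    ∀ i < U.polyDegree S s, 0 < U.node S i := by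
  intro i hi
  have hm : U.m ≤ U.T0 := U.m_le_total
  have hm1 := U.one_le_m
  cases S
  · simp only [polyDegree, sStar, lt_min_iff] at hi
    refine div_pos (sub_pos.2 ?_) U.σ_pos
    exact_mod_cast hi.2.trans_le hm
  · refine div_pos ?_ U.σ_pos
    exact_mod_cast hm1.trans hm

/-- Taking σ out of each factor of the binomial coefficient of xσ + T_0 - l leaves the linear
factors at the nodes l, …, s* - 1; the factorials then combine to a falling factorial of m. -/
theorem P_eq_newtonSum (U : Urn) (s : ℕ) :
    U.P s = Polynomial.newtonSum (U.node .withoutReplacement) (U.polyCoeff s) (U.sStar s) := by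
  have hσ := U.σ_pos.ne'
  rw [P, Polynomial.newtonSum, Finset.mul_sum]
  refine Finset.sum_congr rfl fun l hl => ?_
  have hl : l ≤ U.sStar s := Nat.lt_succ_iff.1 (Finset.mem_range.1 hl)
  obtain ⟨e, he⟩ := Nat.exists_eq_add_of_le hl
  have h1 : ∀ i, Polynomial.C (U.σ : ℝ) * Polynomial.X + Polynomial.C ((U.T0 : ℝ) - (l : ℝ)) -
      Polynomial.C (i : ℝ) = Polynomial.C (U.σ : ℝ) *
        (Polynomial.X + Polynomial.C (((U.T0 : ℝ) - (l + i)) / U.σ)) := by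
    intro i
    rw [mul_add, ← Polynomial.C_mul, mul_div_cancel₀ _ hσ, add_sub_assoc, ← Polynomial.C_sub]
    congr 2
    ring
  simp only [binomPoly, h1, Finset.prod_mul_distrib, Finset.prod_const, Finset.card_range]
  rw [Finset.prod_Ico_eq_prod_range, he, Nat.add_sub_cancel_left]
  simp only [node, Nat.cast_add, ← mul_assoc, ← Polynomial.C_mul, ← Polynomial.C_pow]
  congr 2
  have h2 : ((l + e).choose l : ℝ) * l.factorial * e.factorial = (l + e).factorial := by
    have := Nat.choose_mul_factorial_mul_factorial (Nat.le_add_right l e)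
    rw [Nat.add_sub_cancel_left] at this
    exact_mod_cast this
  have h3 : ((l + e).choose l : ℝ) ≠ 0 := by
    exact_mod_cast (Nat.choose_pos (Nat.le_add_right l e)).ne'
  have h4 : (e.factorial : ℝ) ≠ 0 := by exact_mod_cast e.factorial_ne_zero
  rw [polyCoeff, Nat.descFactorial_eq_factorial_mul_choose, ← h2, div_pow, pow_add]
  push_cast
  field_simp

theorem Q_eq_newtonSum (U : Urn) (s : ℕ) :
    U.Q s = Polynomial.newtonSum (U.node .withReplacement) (U.polyCoeff s) s := by
  have hσ := U.σ_pos.ne'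
  rw [Q, Polynomial.newtonSum, Finset.mul_sum]
  refine Finset.sum_congr rfl fun l hl => ?_
  have hl : l ≤ s := Nat.lt_succ_iff.1 (Finset.mem_range.1 hl)
  obtain ⟨e, rfl⟩ := Nat.exists_eq_add_of_le hl
  have h1 : Polynomial.C (U.σ : ℝ) * Polynomial.X + Polynomial.C (U.T0 : ℝ) =
      Polynomial.C (U.σ : ℝ) * (Polynomial.X + Polynomial.C ((U.T0 : ℝ) / U.σ)) := by
    rw [mul_add, ← Polynomial.C_mul, mul_div_cancel₀ _ hσ]
  simp only [node, Finset.prod_const, Nat.card_Ico, h1, mul_pow, Nat.add_sub_cancel_left]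
  simp only [← mul_assoc, ← Polynomial.C_mul, ← Polynomial.C_pow]
  congr 2
  rw [polyCoeff, Nat.descFactorial_eq_factorial_mul_choose, div_pow, pow_add]
  push_cast
  field_simp

theorem T_cast (U : Urn) (n : ℕ) : (U.T n : ℝ) = U.T0 + U.σ * n := by simp [T]

theorem p_self_withoutReplacement (U : Urn) (n i : ℕ) :
    U.p .withoutReplacement (n + 1) i i = (U.m.choose i : ℝ) / ((U.T n).choose i : ℝ) := by
  simp only [p, Nat.add_sub_cancel]
  rcases le_or_gt i U.m with h | h
  · simp [h, Nat.stirlingFirst_self, Nat.stirlingSecond_self]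
  · rw [Finset.Icc_eq_empty (by simp [h]), Nat.choose_eq_zero_of_lt h]
    simp

theorem p_self_withReplacement (U : Urn) (n i : ℕ) :
    U.p .withReplacement (n + 1) i i = (U.m.descFactorial i : ℝ) / (U.T n : ℝ) ^ i := by
  simp [p, Nat.stirlingSecond_self]

/-- For r = s the inner ranges collapse to i = ℓ = j, so every power of a_m has exponent zero. -/
theorem f_self (U : Urn) (S : SamplingModel) (n s : ℕ) :
    U.f S n s s = ∑ j ∈ Finset.range (s + 1), (s.choose j : ℝ) * U.C ^ j * U.p S n j j := by
  have hm : (U.m : ℝ) ≠ 0 := by exact_mod_cast (Nat.pos_iff_ne_zero.1 U.one_le_m)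
  have hσ := U.σ_pos.ne'
  rw [f, Nat.sub_self, show Finset.range (s + 1) = Finset.Icc 0 s by ext; simp]
  refine Finset.sum_congr rfl fun j _ => ?_
  simp only [Nat.sub_zero, Finset.Icc_self, Finset.sum_singleton, Nat.choose_self, Nat.sub_self,
    Nat.add_zero, pow_zero, mul_one, Nat.cast_one, one_mul, C]
  rw [div_pow, mul_pow]
  ring

theorem f_self_eq_eval_div (U : Urn) (S : SamplingModel) (n s : ℕ) :
    U.f S (n + 1) s s =
      (Polynomial.newtonSum (U.node S) (U.polyCoeff s) (U.polyDegree S s)).eval (n : ℝ) /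
        ∏ i ∈ Finset.range (U.polyDegree S s), ((n : ℝ) + U.node S i) := by
  have hσ := U.σ_pos.ne'
  have hpos : ∀ i < U.polyDegree S s, (n : ℝ) + U.node S i ≠ 0 := fun i hi =>
    (add_pos_of_nonneg_of_pos (Nat.cast_nonneg n) (U.node_pos S s i hi)).ne'
  rw [Polynomial.eval_newtonSum_div_prod _ _ _ _ hpos, f_self]
  cases S with
  | withoutReplacement =>
    have hprod : ∀ l, ∏ i ∈ Finset.range l, ((n : ℝ) + U.node .withoutReplacement i) =
        ((U.T n).descFactorial l : ℝ) / (U.σ : ℝ) ^ l := by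
      intro l
      induction l with
      | zero => simp
      | succ l ih =>
        rw [Finset.prod_range_succ, ih, Nat.cast_descFactorial_succ_mul, node, T_cast]
        field_simp
        ring
    symm
    -- Without replacement the summands with l > m vanish, which is why the degree is min(s, m).
    refine (Finset.sum_subset (Finset.range_subset_range.2 (by simp [polyDegree, sStar]))
      fun l hl hl' => ?_).trans (Finset.sum_congr rfl fun l _ => ?_)
    · have h : U.m < l := by
        simp only [polyDegree, sStar, Finset.mem_range] at hl hl'
        omega
      simp [polyCoeff, Nat.descFactorial_of_lt h]
    · rw [hprod, polyCoeff, p_self_withoutReplacement, Nat.descFactorial_eq_factorial_mul_choose,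
        Nat.descFactorial_eq_factorial_mul_choose]
      have h4 : (l.factorial : ℝ) ≠ 0 := by exact_mod_cast l.factorial_ne_zero
      push_cast
      rw [div_pow]
      field_simp
  | withReplacement =>
    refine Finset.sum_congr rfl fun l _ => ?_
    have hprod : ∏ i ∈ Finset.range l, ((n : ℝ) + U.node .withReplacement i) =
        (U.T n : ℝ) ^ l / (U.σ : ℝ) ^ l := by
      simp only [node, Finset.prod_const, Finset.card_range, ← div_pow, T_cast]
      congr 1
      field_simp
      ring
    have hT : (U.T n : ℝ) ≠ 0 := by exact_mod_cast (U.T_pos n).ne'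
    rw [hprod, polyCoeff, p_self_withReplacement, div_pow]
    field_simp

theorem f_self_pos (U : Urn) (S : SamplingModel) (hC : 0 < U.C) (n s : ℕ) :
    0 < U.f S (n + 1) s s := by
  rw [f_self_eq_eval_div]
  refine div_pos (Polynomial.eval_newtonSum_pos _ _ _ (U.polyCoeff_zero s)
    (U.polyCoeff_nonneg hC s) (U.node_pos S s) (Nat.cast_nonneg n)) (Finset.prod_pos fun i hi => ?_)
  exact add_pos_of_nonneg_of_pos (Nat.cast_nonneg n) (U.node_pos S s i (Finset.mem_range.1 hi))

theorem tendsto_prod_f_self (U : Urn) (S : SamplingModel) (hC : 0 < U.C) {s : ℕ} (hs : 1 ≤ s) :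
    ∃ L : ℝ, L ≠ 0 ∧ (L : ℂ) = (∏ i ∈ Finset.range (U.polyDegree S s),
        Complex.Gamma (U.node S i)) / Urn.gammaNegRoots
          (Polynomial.newtonSum (U.node S) (U.polyCoeff s) (U.polyDegree S s)) ∧
      Tendsto (fun n : ℕ => (∏ j ∈ Finset.range n, U.f S (j + 1) s s) /
        (n : ℝ) ^ ((s : ℝ) * U.Λ)) atTop (𝓝 L) := by
  have h := Polynomial.tendsto_prod_newtonSum (U.node S) (U.polyCoeff s) (U.polyDegree S s)
    (U.polyDegree_ne_zero S hs) (U.polyCoeff_zero s) (U.polyCoeff_nonneg hC s) (U.node_pos S s)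
  simpa only [f_self_eq_eval_div, polyCoeff_one] using h

/-! ### Growth of the coefficients -/

theorem succ_le_T (U : Urn) (n : ℕ) : n + 1 ≤ U.T n := by
  have h1 : U.m ≤ U.T0 := U.m_le_total
  have h2 : n ≤ U.σ * n := Nat.le_mul_of_pos_left n U.one_le_σ
  have := U.one_le_m
  simp only [T]
  omega

theorem p_isBigO (U : Urn) (S : SamplingModel) (i l : ℕ) :
    (fun n : ℕ => U.p S (n + 1) i l) =O[atTop] fun n : ℕ => (((n : ℝ) + 1) ^ l)⁻¹ := by
  cases S with
  | withoutReplacement =>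
    simp only [p, Nat.add_sub_cancel]
    refine Asymptotics.IsBigO.fun_sum fun h hh => ?_
    have hl : l ≤ h := (Finset.mem_Icc.1 hh).1
    have hm : h ≤ U.m := (Finset.mem_Icc.1 hh).2.trans (min_le_right _ _)
    simp_rw [div_eq_mul_inv]
    refine Asymptotics.IsBigO.const_mul_left ?_ _
    refine Asymptotics.IsBigO.of_bound (h.factorial : ℝ) (Eventually.of_forall fun n => ?_)
    have h0 : (0 : ℝ) < h.factorial := by exact_mod_cast h.factorial_pos
    -- The binomial coefficient is at least (T_n + 1 - h)^h/h!, and T_n + 1 - h ≥ n + 1 because h ≤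
    -- m ≤ T_0 and σ ≥ 1.
    have h1 := Nat.pow_le_choose (α := ℝ) h (U.T n)
    have h2 : n + 1 ≤ U.T n + 1 - h := by
      have h3 : U.m ≤ U.T0 := U.m_le_total
      have h4 : n ≤ U.σ * n := Nat.le_mul_of_pos_left n U.one_le_σ
      simp only [T]
      omega
    have h3 : ((n : ℝ) + 1) ^ h ≤ ((U.T n + 1 - h : ℕ) : ℝ) ^ h := by
      gcongr
      exact_mod_cast h2
    have h4 : ((n : ℝ) + 1) ^ l ≤ ((n : ℝ) + 1) ^ h :=
      pow_le_pow_right₀ (by linarith [Nat.cast_nonneg (α := ℝ) n]) hl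
    have h5 : (0 : ℝ) < ((n : ℝ) + 1) ^ l := by positivity
    have h6 : ((n : ℝ) + 1) ^ l / h.factorial ≤ (U.T n).choose h :=
      (div_le_div_of_nonneg_right (h4.trans h3) h0.le).trans (by exact_mod_cast h1)
    have h7 : 0 < ((n : ℝ) + 1) ^ l / h.factorial := by positivity
    rw [Real.norm_of_nonneg (by positivity), Real.norm_of_nonneg (by positivity)]
    refine (inv_anti₀ h7 h6).trans (le_of_eq ?_)
    rw [inv_div, div_eq_mul_inv]
  | withReplacement =>
    simp only [p, Nat.add_sub_cancel, div_eq_mul_inv]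
    refine Asymptotics.IsBigO.const_mul_left ?_ _
    refine Asymptotics.IsBigO.of_bound 1 (Eventually.of_forall fun n => ?_)
    have h2 := U.succ_le_T n
    rw [Real.norm_of_nonneg (by positivity), Real.norm_of_nonneg (by positivity), one_mul]
    refine inv_anti₀ (by positivity) ?_
    gcongr
    exact_mod_cast h2

theorem inv_pow_isBigO_inv_pow {t t' : ℕ} (h : t' ≤ t) :
    (fun n : ℕ => (((n : ℝ) + 1) ^ t)⁻¹) =O[atTop] fun n : ℕ => (((n : ℝ) + 1) ^ t')⁻¹ := by
  refine Asymptotics.IsBigO.of_bound 1 (Eventually.of_forall fun n => ?_)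
  rw [Real.norm_of_nonneg (by positivity), Real.norm_of_nonneg (by positivity), one_mul]
  exact inv_anti₀ (by positivity)
    (pow_le_pow_right₀ (by linarith [Nat.cast_nonneg (α := ℝ) n]) h)

/-- Power counting: the drift contributes at most n^{l-(j-(s-r))} and the sample moment n^{-l}, so
the order does not depend on l. -/
theorem f_summand_isBigO (U : Urn) (S : SamplingModel) (s r j : ℕ) (hj : s - r ≤ j) :
    (fun n : ℕ => (s.choose j : ℝ) * U.Λ ^ j *
      ∑ l ∈ Finset.Icc (j - (s - r)) j, (l.choose (j - (s - r)) : ℝ) *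
        ((U.am : ℝ) * (((n + 1 : ℕ) : ℝ) - 1) / (1 - U.Λ)) ^ (l + (s - r) - j) *
        ∑ i ∈ Finset.Icc l j, (j.choose i : ℝ) *
          (((U.σ : ℝ) ^ i * (U.am : ℝ) ^ (j - i)) / ((U.m : ℝ) ^ i * (U.Λ - 1) ^ (j - i))) *
          U.p S (n + 1) i l) =O[atTop] fun n : ℕ => (((n : ℝ) + 1) ^ (j - (s - r)))⁻¹ := by
  refine Asymptotics.IsBigO.const_mul_left ?_ _
  refine Asymptotics.IsBigO.fun_sum fun l hl => ?_
  have hl := (Finset.mem_Icc.1 hl).1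
  have h1 : (fun n : ℕ => (l.choose (j - (s - r)) : ℝ) *
      ((U.am : ℝ) * (((n + 1 : ℕ) : ℝ) - 1) / (1 - U.Λ)) ^ (l + (s - r) - j)) =O[atTop]
      fun n : ℕ => ((n : ℝ) + 1) ^ (l + (s - r) - j) := by
    refine Asymptotics.IsBigO.const_mul_left (Asymptotics.IsBigO.pow ?_ _) _
    refine Asymptotics.IsBigO.of_bound |(U.am : ℝ) / (1 - U.Λ)| (Eventually.of_forall fun n => ?_)
    have : (U.am : ℝ) * (((n + 1 : ℕ) : ℝ) - 1) / (1 - U.Λ) = (U.am : ℝ) / (1 - U.Λ) * n := by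
      push_cast
      ring
    rw [this, norm_mul, Real.norm_eq_abs]
    gcongr
    rw [Real.norm_of_nonneg (by positivity), Real.norm_of_nonneg (by positivity)]
    linarith
  have h2 : (fun n : ℕ => ∑ i ∈ Finset.Icc l j, (j.choose i : ℝ) *
          (((U.σ : ℝ) ^ i * (U.am : ℝ) ^ (j - i)) / ((U.m : ℝ) ^ i * (U.Λ - 1) ^ (j - i))) *
          U.p S (n + 1) i l) =O[atTop] fun n : ℕ => (((n : ℝ) + 1) ^ l)⁻¹ :=
    Asymptotics.IsBigO.fun_sum fun i _ => (U.p_isBigO S i l).const_mul_left _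
  refine (h1.mul h2).trans (Asymptotics.IsBigO.of_bound 1 (Eventually.of_forall fun n => ?_))
  have h3 : (0 : ℝ) < (n : ℝ) + 1 := by positivity
  rw [one_mul, Real.norm_of_nonneg (by positivity), Real.norm_of_nonneg (by positivity),
    mul_inv_le_iff₀ (by positivity), mul_comm, ← div_eq_mul_inv, le_div_iff₀ (by positivity),
    ← pow_add]
  refine pow_le_pow_right₀ (by linarith [Nat.cast_nonneg (α := ℝ) n]) ?_
  omega

theorem f_isBigO_one (U : Urn) (S : SamplingModel) (s r : ℕ) :
    (fun n : ℕ => U.f S (n + 1) s r) =O[atTop] fun _ : ℕ => (1 : ℝ) := by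
  refine Asymptotics.IsBigO.fun_sum fun j hj =>
    (U.f_summand_isBigO S s r j (Finset.mem_Icc.1 hj).1).trans ?_
  simpa using inv_pow_isBigO_inv_pow (Nat.zero_le (j - (s - r)))

/-- Up to terms of order `1 / n`, the coefficient `f_{n,s,r}` is determined by
`f_{n,s-r,0}`. -/
theorem f_isBigO_inv (U : Urn) (S : SamplingModel) {s r : ℕ}
    (h0 : (fun n : ℕ => U.f S (n + 1) (s - r) 0) =O[atTop] fun n : ℕ => ((n : ℝ) + 1)⁻¹) :
    (fun n : ℕ => U.f S (n + 1) s r) =O[atTop] fun n : ℕ => ((n : ℝ) + 1)⁻¹ := by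
  refine Asymptotics.IsBigO.fun_sum fun j hj => ?_
  have hj := Finset.mem_Icc.1 hj
  rcases hj.1.eq_or_lt with h | h
  -- The lowest summand j = s - r is exactly a binomial coefficient times f_{n,s-r,0}; all others
  -- are already O(1/n).
  · subst h
    refine (h0.const_mul_left (s.choose (s - r) : ℝ)).congr_left fun n => ?_
    simp only [f, Nat.sub_zero, Finset.Icc_self, Finset.sum_singleton, Nat.choose_self,
      Nat.cast_one, one_mul, mul_assoc]
  · refine (U.f_summand_isBigO S s r j hj.1).trans ?_
    simpa using inv_pow_isBigO_inv_pow (show 1 ≤ j - (s - r) by omega)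

theorem p_zero_zero (U : Urn) (S : SamplingModel) (n : ℕ) : U.p S n 0 0 = 1 := by
  cases S <;> simp [p]

theorem p_succ_zero (U : Urn) (S : SamplingModel) (n i : ℕ) : U.p S n (i + 1) 0 = 0 := by
  cases S
  · simp only [p]
    refine Finset.sum_eq_zero fun h _ => ?_
    cases h <;> simp
  · simp [p]

theorem p_one_one (U : Urn) (S : SamplingModel) (n : ℕ) :
    U.p S (n + 1) 1 1 = (U.m : ℝ) / U.T n := by
  cases S
  · simp [p_self_withoutReplacement]
  · simp [p_self_withReplacement]

theorem drift_mul {U : Urn} {S : SamplingModel} (hT : U.Tenable S) (hA : U.IsAffine S) :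
    U.drift * (1 - U.Λ) = U.am := by
  by_cases h : U.Λ = 1
  · simp [am_eq_zero_of_Λ_eq_one hT hA h, h]
  · have h1 : 1 - U.Λ ≠ 0 := fun h' => h (by linarith)
    rw [drift, div_mul_cancel₀ _ h1]

/-- The centring is chosen for this: the bounded part cancels because the drift times 1 - Λ is a_m,
and a term of order 1/n is left. -/
theorem f_one_zero {U : Urn} {S : SamplingModel} (hT : U.Tenable S) (hA : U.IsAffine S) (n : ℕ) :
    U.f S (n + 1) 1 0 = -(U.Λ * U.drift * U.T0 / U.T n) := by
  have h := U.sum_f_mul_pow S n 1 0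
  have hm : (U.m : ℝ) ≠ 0 := by exact_mod_cast (Nat.pos_iff_ne_zero.1 U.one_le_m)
  have hTn : (U.T n : ℝ) ≠ 0 := by exact_mod_cast (U.T_pos n).ne'
  simp [Finset.sum_range_succ, p_zero_zero, p_succ_zero U S _ 0, p_one_one] at h
  rw [h, mul_add, ← drift_eq hT hA, ← drift_mul hT hA]
  field_simp
  rw [T_cast]
  ring

theorem f_one_one (U : Urn) (S : SamplingModel) (n : ℕ) :
    U.f S (n + 1) 1 1 = 1 + U.Λ * U.σ / U.T n := by
  have hm : (U.m : ℝ) ≠ 0 := by exact_mod_cast (Nat.pos_iff_ne_zero.1 U.one_le_m)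
  rw [f_self]
  simp only [Finset.sum_range_succ, Finset.range_zero, Finset.sum_empty, p_zero_zero, p_one_one, C]
  simp
  field_simp

/-- If a_m = 0, an urn without white balls never receives any, so the conditional moment has no
constant term. -/
theorem f_zero_right_of_am_eq_zero (U : Urn) (S : SamplingModel) (h : U.am = 0) (n s : ℕ)
    (hs : 1 ≤ s) : U.f S n s 0 = 0 := by
  simp only [f, h, Nat.sub_zero, Finset.Icc_self, Finset.sum_singleton, Nat.sub_self,
    Int.cast_zero, zero_mul, zero_div]
  rw [Finset.sum_eq_zero, mul_zero]
  intro l _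
  rcases Nat.eq_zero_or_pos l with rfl | hl
  · rw [Finset.sum_eq_zero, mul_zero]
    intro i _
    cases i with
    | zero => simp [Nat.pos_iff_ne_zero.1 hs]
    | succ i => rw [p_succ_zero, mul_zero]
  · rw [Nat.add_sub_cancel, zero_pow hl.ne', mul_zero, zero_mul]

/-- The growth of the coefficients `f_{n,s,r}`, `r < s`, in the two cases of the theorem. -/
theorem exists_f_isBigO_rpow {U : Urn} {S : SamplingModel} (hT : U.Tenable S) (hA : U.IsAffine S)
    (hCase : U.IsLargeIndex ∨ U.IsTriangular) :
    ∃ ρ : ℝ, 1 < ρ ∧ ∀ s r : ℕ, r < s → (fun n : ℕ => U.f S (n + 1) s r) =O[atTop]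
      fun n : ℕ => ((n : ℝ) + 1) ^ (((s : ℝ) - r) * U.Λ - ρ) := by
  have hΛ := U.Λ_pos hCase
  have hmono : ∀ {x y : ℝ}, x ≤ y → (fun n : ℕ => ((n : ℝ) + 1) ^ x) =O[atTop]
      fun n : ℕ => ((n : ℝ) + 1) ^ y := by
    intro x y hxy
    refine Asymptotics.IsBigO.of_bound 1 (Eventually.of_forall fun n => ?_)
    rw [one_mul, Real.norm_of_nonneg (by positivity), Real.norm_of_nonneg (by positivity)]
    exact Real.rpow_le_rpow_of_exponent_le (by linarith [Nat.cast_nonneg (α := ℝ) n]) hxy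
  have hinv : (fun n : ℕ => ((n : ℝ) + 1)⁻¹) = fun n : ℕ => ((n : ℝ) + 1) ^ (-1 : ℝ) := by
    funext n
    rw [Real.rpow_neg_one]
  have hone : (fun _ : ℕ => (1 : ℝ)) = fun n : ℕ => ((n : ℝ) + 1) ^ (0 : ℝ) := by
    funext n
    rw [Real.rpow_zero]
  rcases hCase with h | h
  · have h : 1 / 2 < U.Λ := h
    -- Gaps s - r ≥ 2 have only the bound O(1) and need ρ ≤ 2Λ; the gap 1 has O(1/n) and needs ρ ≤ 1
    -- + Λ. The large index makes 2Λ exceed 1.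
    refine ⟨min (1 + U.Λ) (2 * U.Λ), lt_min (by linarith) (by linarith), fun s r hrs => ?_⟩
    rcases Nat.lt_or_ge (r + 1) s with h1 | h1
    · have h2 := U.f_isBigO_one S s r
      rw [hone] at h2
      refine h2.trans (hmono ?_)
      have h3 : (2 : ℝ) ≤ (s : ℝ) - r := by
        have : ((r + 2 : ℕ) : ℝ) ≤ s := Nat.cast_le.2 h1
        push_cast at this
        linarith
      nlinarith [min_le_right (1 + U.Λ) (2 * U.Λ)]
    · obtain rfl : s = r + 1 := by omega
      have h2 : (fun n : ℕ => U.f S (n + 1) (r + 1 - r) 0) =O[atTop]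
          fun n : ℕ => ((n : ℝ) + 1)⁻¹ := by
        simp only [Nat.add_sub_cancel_left, f_one_zero hT hA]
        refine Asymptotics.IsBigO.neg_left ?_
        simp only [div_eq_mul_inv]
        refine Asymptotics.IsBigO.const_mul_left ?_ _
        refine Asymptotics.IsBigO.of_bound 1 (Eventually.of_forall fun n => ?_)
        have h4 := U.succ_le_T n
        rw [Real.norm_of_nonneg (by positivity), Real.norm_of_nonneg (by positivity), one_mul]
        exact inv_anti₀ (by positivity) (by exact_mod_cast h4)
      have h3 := U.f_isBigO_inv S h2
      rw [hinv] at h3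
      refine h3.trans (hmono ?_)
      push_cast
      linarith [min_le_left (1 + U.Λ) (2 * U.Λ)]
  -- In the triangular case every gap has the bound O(1/n), so any Λ > 0 will do.
  · refine ⟨1 + U.Λ, by linarith, fun s r hrs => ?_⟩
    have h2 : (fun n : ℕ => U.f S (n + 1) (s - r) 0) =O[atTop]
        fun n : ℕ => ((n : ℝ) + 1)⁻¹ := by
      simp only [U.f_zero_right_of_am_eq_zero S h.1 _ _ (show 1 ≤ s - r by omega)]
      exact Asymptotics.isBigO_zero _ _
    have h3 := U.f_isBigO_inv S h2
    rw [hinv] at h3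
    refine h3.trans (hmono ?_)
    have h4 : (1 : ℝ) ≤ (s : ℝ) - r := by
      have : ((r + 1 : ℕ) : ℝ) ≤ s := Nat.cast_le.2 hrs
      push_cast at this
      linarith
    nlinarith

end Urn

/-! ### Induction on the order of the moments, and the first moment. -/

namespace Urn

namespace IsDrawSequence

variable {U : Urn} {S : SamplingModel} {Ω : Type*} [mΩ : MeasurableSpace Ω] {μ : Measure Ω}
  {K : ℕ → Ω → Fin (U.m + 1)}

/-- Moments of order `s` grow at most like `n ^ (s Λ)`, and the terms of the series decay like
`n ^ (-ρ)`. -/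
theorem term_isBigO {ρ : ℝ} (hC : 0 < U.C)
    (hρ : ∀ s r : ℕ, r < s → (fun n : ℕ => U.f S (n + 1) s r) =O[atTop]
      fun n : ℕ => ((n : ℝ) + 1) ^ (((s : ℝ) - r) * U.Λ - ρ)) {s : ℕ} (hs : 1 ≤ s)
    (hM : ∀ i < s, (fun n : ℕ => U.moment μ K i n) =O[atTop]
      fun n : ℕ => ((n : ℝ) + 1) ^ ((i : ℝ) * U.Λ)) :
    (fun n : ℕ => U.term S μ K s (n + 1)) =O[atTop] fun n : ℕ => ((n : ℝ) + 1) ^ (-ρ) := by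
  obtain ⟨L, hL0, -, hL⟩ := U.tendsto_prod_f_self S hC hs
  have hprod : (fun n : ℕ => (∏ j ∈ Finset.range (n + 1), U.f S (j + 1) s s)⁻¹) =O[atTop]
      fun n : ℕ => ((n : ℝ) + 1) ^ (-((s : ℝ) * U.Λ)) := by
    have h1 := (((tendsto_add_atTop_iff_nat 1).2 hL).inv₀ hL0)
    refine Asymptotics.isBigO_of_div_tendsto_nhds (Eventually.of_forall fun n h => ?_) L⁻¹
      (h1.congr fun n => ?_)
    · exact absurd h (Real.rpow_pos_of_pos (by positivity) _).ne'
    · simp only [Pi.div_apply]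
      rw [inv_div, Real.rpow_neg (by positivity), div_inv_eq_mul, Nat.cast_add, Nat.cast_one,
        div_eq_mul_inv, mul_comm]
  -- The exponents (s - i)Λ - ρ and iΛ add up to sΛ - ρ for every i.
  have hsum : (fun n : ℕ => ∑ i ∈ Finset.range s, U.f S (n + 1) s i * U.moment μ K i n) =O[atTop]
      fun n : ℕ => ((n : ℝ) + 1) ^ ((s : ℝ) * U.Λ - ρ) := by
    refine Asymptotics.IsBigO.fun_sum fun i hi => ?_
    have hi := Finset.mem_range.1 hi
    refine ((hρ s i hi).mul (hM i hi)).congr_right fun n => ?_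
    rw [← Real.rpow_add (by positivity)]
    congr 1
    ring
  refine (hsum.mul hprod).congr (fun n => ?_) fun n => ?_
  · rw [term, Finset.prod_Icc_one_eq_prod_range, div_eq_mul_inv]
    rfl
  · rw [← Real.rpow_add (by positivity)]
    congr 1
    ring

theorem summable_term {ρ : ℝ} (hC : 0 < U.C) (hρ1 : 1 < ρ)
    (hρ : ∀ s r : ℕ, r < s → (fun n : ℕ => U.f S (n + 1) s r) =O[atTop]
      fun n : ℕ => ((n : ℝ) + 1) ^ (((s : ℝ) - r) * U.Λ - ρ)) {s : ℕ} (hs : 1 ≤ s)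
    (hM : ∀ i < s, (fun n : ℕ => U.moment μ K i n) =O[atTop]
      fun n : ℕ => ((n : ℝ) + 1) ^ ((i : ℝ) * U.Λ)) :
    Summable fun n : ℕ => U.term S μ K s (n + 1) := by
  refine summable_of_isBigO_nat ?_ (term_isBigO hC hρ hs hM)
  have h := (summable_nat_add_iff 1).2 (Real.summable_nat_rpow.2 (by linarith : -ρ < -1))
  simpa using h

theorem tendsto_moment_of_summable [IsProbabilityMeasure μ] (hK : U.IsDrawSequence S μ K)
    (hT : U.Tenable S) (hA : U.IsAffine S) (hC : 0 < U.C) {s : ℕ} {L : ℝ}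
    (hL : Tendsto (fun n : ℕ => (∏ j ∈ Finset.range n, U.f S (j + 1) s s) /
        (n : ℝ) ^ ((s : ℝ) * U.Λ)) atTop (𝓝 L))
    (hsum : Summable fun n : ℕ => U.term S μ K s (n + 1)) :
    Tendsto (fun n : ℕ => U.moment μ K s n / (n : ℝ) ^ ((s : ℝ) * U.Λ)) atTop
      (𝓝 (L * ((U.W0 : ℝ) ^ s + ∑' l : ℕ, U.term S μ K s (l + 1)))) := by
  refine (hL.mul (hsum.hasSum.tendsto_sum_nat.const_add _)).congr fun n => ?_
  rw [hK.moment_eq_prod_mul hT hA s (fun j => (U.f_self_pos S hC j s).ne') n]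
  ring

/-- Bounds for the lower moments make the series of order s summable; the resulting limit bounds the
moment of order s. -/
theorem moment_isBigO [IsProbabilityMeasure μ] (hK : U.IsDrawSequence S μ K)
    (hT : U.Tenable S) (hA : U.IsAffine S) (hCase : U.IsLargeIndex ∨ U.IsTriangular) (s : ℕ) :
    (fun n : ℕ => U.moment μ K s n) =O[atTop]
      fun n : ℕ => ((n : ℝ) + 1) ^ ((s : ℝ) * U.Λ) := by
  have hC := U.C_pos hCase
  have hΛ := U.Λ_pos hCase
  obtain ⟨ρ, hρ1, hρ⟩ := exists_f_isBigO_rpow hT hA hCase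
  induction s using Nat.strong_induction_on with
  | _ s ih =>
    rcases Nat.eq_zero_or_pos s with rfl | hs
    · simp only [moment_zero_left, Nat.cast_zero, zero_mul, Real.rpow_zero]
      exact Asymptotics.isBigO_refl _ _
    · obtain ⟨L, -, -, hL⟩ := U.tendsto_prod_f_self S hC hs
      have h1 := hK.tendsto_moment_of_summable hT hA hC hL (summable_term hC hρ1 hρ hs ih)
      have h2 : (fun n : ℕ => U.moment μ K s n) =O[atTop]
          fun n : ℕ => (n : ℝ) ^ ((s : ℝ) * U.Λ) := by
        refine Asymptotics.isBigO_of_div_tendsto_nhds ?_ _ h1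
        filter_upwards [eventually_gt_atTop 0] with n hn h
        exact absurd h (Real.rpow_pos_of_pos (by exact_mod_cast hn) _).ne'
      refine h2.trans (Asymptotics.IsBigO.of_bound 1 (Eventually.of_forall fun n => ?_))
      rw [one_mul, Real.norm_of_nonneg (by positivity), Real.norm_of_nonneg (by positivity)]
      exact Real.rpow_le_rpow (by positivity) (by linarith) (by positivity)

/-- The first moment is available in closed form. -/
theorem moment_one_sub [IsProbabilityMeasure μ] (hK : U.IsDrawSequence S μ K)
    (hT : U.Tenable S) (hA : U.IsAffine S) (n : ℕ) :
    U.moment μ K 1 n - U.drift * U.T0 / U.σ =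
      (∏ j ∈ Finset.range n, U.f S (j + 1) 1 1) * ((U.W0 : ℝ) - U.drift * U.T0 / U.σ) := by
  induction n with
  | zero => simp [moment_zero_right]
  | succ n ih =>
    have hTn : (U.T n : ℝ) ≠ 0 := by exact_mod_cast (U.T_pos n).ne'
    have hσ := U.σ_pos.ne'
    -- The subtracted constant is a fixed point of the recursion of order one, so the difference
    -- obeys a homogeneous recursion.
    rw [Finset.prod_range_succ, mul_right_comm, ← ih, hK.moment_succ hT hA,
      Finset.sum_range_succ, Finset.sum_range_one, moment_zero_left, f_one_zero hT hA, f_one_one]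
    field_simp
    ring

end IsDrawSequence

theorem gammaNegRoots_newtonSum_one (ν c : ℕ → ℝ) (hc : c 0 = 1) :
    gammaNegRoots (Polynomial.newtonSum ν c 1) = Complex.Gamma ((ν 0 + c 1 : ℝ) : ℂ) := by
  have h : Polynomial.newtonSum ν c 1 = Polynomial.X - Polynomial.C (-(ν 0 + c 1)) := by
    simp [Polynomial.newtonSum, Finset.sum_range_succ, hc]
    ring
  rw [gammaNegRoots, h, Polynomial.aroots_X_sub_C]
  simp

theorem node_zero (U : Urn) (S : SamplingModel) : U.node S 0 = (U.T0 : ℝ) / U.σ := by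
  cases S <;> simp [node]

theorem polyDegree_one (U : Urn) (S : SamplingModel) : U.polyDegree S 1 = 1 := by
  have := U.one_le_m
  cases S
  · simp [polyDegree, sStar, this]
  · rfl

end Urn

/-! ### Assembly of the theorem. -/

theorem mainTheorem1 (U : Urn) (S : SamplingModel)
    (hTenable : U.Tenable S) (hAffine : U.IsAffine S)
    (hCase : U.IsLargeIndex ∨ U.IsTriangular)
    {Ω : Type*} [MeasurableSpace Ω] (μ : Measure Ω) [IsProbabilityMeasure μ]
    (K : ℕ → Ω → Fin (U.m + 1)) (hK : U.IsDrawSequence S μ K) :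
    ∃ E : ℕ → ℝ,
      -- existence of the limits
      (∀ s : ℕ, 1 ≤ s →
        Tendsto (fun n : ℕ => ∫ ω, (U.shifted K n ω) ^ s / (n : ℝ) ^ ((s : ℝ) * U.Λ) ∂μ)
          atTop (𝓝 (E s))) ∧
      -- the first moment
      E 1 = ((U.W0 : ℝ) - ((U.am : ℝ) * (U.T0 : ℝ) / (U.σ : ℝ)) / (1 - U.Λ)) *
          (Real.Gamma ((U.T0 : ℝ) / (U.σ : ℝ)) / Real.Gamma ((U.T0 : ℝ) / (U.σ : ℝ) + U.Λ)) ∧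
      -- the infinite sums are well defined and convergent
      (∀ s : ℕ, 1 ≤ s →
        (∀ j : ℕ, 1 ≤ j → 0 < U.f S j s s) ∧
        Summable (fun ℓ : ℕ => U.term S μ K s (ℓ + 1))) ∧
      -- sampling without replacement
      (S = SamplingModel.withoutReplacement → ∀ s : ℕ, 1 ≤ s →
        (U.P s).Monic ∧ (U.P s).natDegree = U.sStar s ∧
        (∀ z ∈ (U.P s).aroots ℂ, ∀ n : ℕ, -z ≠ -(n : ℂ)) ∧
        (E s : ℂ) =
          (∏ ℓ ∈ Finset.Icc 1 (U.sStar s),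
              Complex.Gamma (((U.T0 : ℂ) + 1 - (ℓ : ℂ)) / (U.σ : ℂ))) /
            Urn.gammaNegRoots (U.P s) *
          (((U.W0 : ℝ) ^ s + ∑' ℓ : ℕ, U.term S μ K s (ℓ + 1) : ℝ) : ℂ)) ∧
      -- sampling with replacement
      (S = SamplingModel.withReplacement → ∀ s : ℕ, 1 ≤ s →
        (U.Q s).Monic ∧ (U.Q s).natDegree = s ∧
        (∀ z ∈ (U.Q s).aroots ℂ, ∀ n : ℕ, -z ≠ -(n : ℂ)) ∧
        (E s : ℂ) =
          Complex.Gamma ((U.T0 : ℂ) / (U.σ : ℂ)) ^ s / Urn.gammaNegRoots (U.Q s) *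
          (((U.W0 : ℝ) ^ s + ∑' ℓ : ℕ, U.term S μ K s (ℓ + 1) : ℝ) : ℂ)) := by
  have hC := U.C_pos hCase
  have hΛ := U.Λ_pos hCase
  obtain ⟨ρ, hρ1, hρ⟩ := Urn.exists_f_isBigO_rpow hTenable hAffine hCase
  have hsum : ∀ s : ℕ, 1 ≤ s → Summable (fun ℓ : ℕ => U.term S μ K s (ℓ + 1)) := fun s hs =>
    Urn.IsDrawSequence.summable_term hC hρ1 hρ hs
      fun i _ => hK.moment_isBigO hTenable hAffine hCase i
  have hLim : ∀ s : ℕ, 1 ≤ s → ∃ L : ℝ,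
      (L : ℂ) = (∏ i ∈ Finset.range (U.polyDegree S s), Complex.Gamma (U.node S i)) /
        Urn.gammaNegRoots
          (Polynomial.newtonSum (U.node S) (U.polyCoeff s) (U.polyDegree S s)) ∧
      Tendsto (fun n : ℕ => (∏ j ∈ Finset.range n, U.f S (j + 1) s s) /
        (n : ℝ) ^ ((s : ℝ) * U.Λ)) atTop (𝓝 L) 
      := fun s hs => (U.tendsto_prod_f_self S hC hs).imp fun _ h => h.2
  choose! L hLeq hL using hLim
  have hmom : ∀ s : ℕ, 1 ≤ s → Tendsto
      (fun n : ℕ => U.moment μ K s n / (n : ℝ) ^ ((s : ℝ) * U.Λ)) atTop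
      (𝓝 (L s * ((U.W0 : ℝ) ^ s + ∑' l : ℕ, U.term S μ K s (l + 1)))) := fun s hs =>
    hK.tendsto_moment_of_summable hTenable hAffine hC (hL s hs) (hsum s hs)
  refine ⟨fun s => L s * ((U.W0 : ℝ) ^ s + ∑' l : ℕ, U.term S μ K s (l + 1)), ?_, ?_, ?_, ?_, ?_⟩
  · intro s hs
    simpa only [integral_div, Urn.moment] using hmom s hs
  -- The closed form of the first moment gives a second expression for the same limit, as its
  -- additive constant disappears after division by n^Λ with Λ > 0.
  · have h1 : Tendsto (fun n : ℕ => U.moment μ K 1 n / (n : ℝ) ^ (((1 : ℕ) : ℝ) * U.Λ)) atTop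
        (𝓝 (L 1 * ((U.W0 : ℝ) - U.drift * U.T0 / U.σ) + 0)) := by
      have h2 : Tendsto (fun n : ℕ => U.drift * U.T0 / U.σ / (n : ℝ) ^ (((1 : ℕ) : ℝ) * U.Λ)) atTop
          (𝓝 0) := by
        refine Tendsto.const_div_atTop ?_ _
        exact (tendsto_rpow_atTop (by simpa using hΛ)).comp tendsto_natCast_atTop_atTop
      refine (((hL 1 le_rfl).mul_const _).add h2).congr fun n => ?_
      have := hK.moment_one_sub hTenable hAffine n
      rw [div_mul_eq_mul_div, ← this, ← add_div, sub_add_cancel]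
    have h3 := tendsto_nhds_unique (hmom 1 le_rfl) h1
    have h4 : L 1 = Real.Gamma ((U.T0 : ℝ) / (U.σ : ℝ)) /
        Real.Gamma ((U.T0 : ℝ) / (U.σ : ℝ) + U.Λ) := by
      have h5 := hLeq 1 le_rfl
      rw [U.polyDegree_one S, Finset.prod_range_one, Urn.gammaNegRoots_newtonSum_one _ _
        (U.polyCoeff_zero 1), U.node_zero, U.polyCoeff_one, Nat.cast_one, one_mul,
        Complex.Gamma_ofReal, Complex.Gamma_ofReal] at h5
      exact_mod_cast h5
    refine h3.trans ?_
    rw [h4, Urn.drift]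
    ring
  · intro s hs
    refine ⟨fun j hj => ?_, hsum s hs⟩
    obtain ⟨j, rfl⟩ := Nat.exists_eq_add_of_le' hj
    exact U.f_self_pos S hC j s
  · rintro rfl s hs
    rw [U.P_eq_newtonSum]
    refine ⟨Polynomial.monic_newtonSum _ _ _ (U.polyCoeff_zero s),
      Polynomial.natDegree_newtonSum _ _ _ (U.polyCoeff_zero s),
      Polynomial.ne_natCast_of_mem_aroots_newtonSum _ _ _ (U.polyCoeff_zero s)
        (U.polyCoeff_nonneg hC s) (U.node_pos .withoutReplacement s), ?_⟩
    rw [Complex.ofReal_mul, hLeq s hs, Finset.prod_Icc_one_eq_prod_range]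
    congr 2
    refine Finset.prod_congr rfl fun i _ => ?_
    congr 1
    simp only [Urn.node]
    push_cast
    ring
  · rintro rfl s hs
    rw [U.Q_eq_newtonSum]
    refine ⟨Polynomial.monic_newtonSum _ _ _ (U.polyCoeff_zero s),
      Polynomial.natDegree_newtonSum _ _ _ (U.polyCoeff_zero s),
      Polynomial.ne_natCast_of_mem_aroots_newtonSum _ _ _ (U.polyCoeff_zero s)
        (U.polyCoeff_nonneg hC s) (U.node_pos .withReplacement s), ?_⟩
    rw [Complex.ofReal_mul, hLeq s hs]
    simp only [Urn.polyDegree, Urn.node, Finset.prod_const, Finset.card_range, Complex.ofReal_div,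
      Complex.ofReal_natCast]
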